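/- Let $(N,\mathcal T)$ be a triangulated closed pseudo 3-manifold: $N$ is the quotient of a finite disjoint union $T$ of Euclidean tetrahedra by affine homeomorphisms that identify all their codimension-1 faces in pairs. Let $E$ be the set of edges of $\mathcal T$, that is, of equivalence classes of edges of tetrahedra in $T$ under the identifications. A non-negative (respectively positive) angle structure $\alpha$ on $(N,\mathcal T)$ assigns to each edge of each tetrahedron in $T$ a non-negative (respectively positive) real number, called the angle, so that the sum of the angles around each edge in $E$ is $2\pi$ (counted with multiplicity) and the sum of the angles at the three edges from each vertex of each tetrahedron is $\pi$; consequently opposite edges of a tetrahedron have equal angles. Its volume is $vol(\alpha)=\sum_{\sigma\in T}\frac12\sum_{e}\Lambda(\alpha_\sigma(e))$, where $e$ runs over the six edges of $\sigma$, $\alpha_\sigma(e)$ is the angle at $e$, and $\Lambda(x)=-\int_0^x\ln|2\sin t|\,dt$. A decorated ideal tetrahedron is an ideal tetrahedron in $\mathbb H^3$, with its four ideal vertices not on a round circle of $\partial\mathbb H^3$, together with a horosphere centred at each vertex. The length of an edge of it is the signed distance along the edge between the horospheres at the two ends of the edge, positive if these horospheres are disjoint and non-positive if they meet. Suppose that $(N,\mathcal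 T)$ supports a positive angle structure. Let $\alpha$ be a non-negative angle structure that maximizes volume in the space of all non-negative angle structures on $(N,\mathcal T)$. Then there is a function $l:E\to\mathbb R$ such that for each tetrahedron $\sigma\in T$: (1) if all angles of $\sigma$ in $\alpha$ are positive, then they are the dihedral angles of the decorated ideal tetrahedron whose edge lengths are given by $l$; (2) if some angle of $\sigma$ in $\alpha$ is $0$, then the angles of $\sigma$ in $\alpha$ are $0,0,0,0,\pi,\pi$, and the edge lengths given by $l$ satisfy $$e^{\frac{l_1+l_4}{2}}\ \ge\ e^{\frac{l_2+l_5}{2}}+e^{\frac{l_3+l_6}{2}},$$ where $l_1$ is the length of an edge of angle $\pi$ and $l_i$, $l_{i+3}$ are the lengths of opposite edges. Conversely, if $l:E\to\mathbb R$ is any function and $\alpha$ is a non-negative angle structure on $(N,\mathcal T)$ such that (1) and (2) hold for every $\sigma\in T$, then $\alpha$ maximizes volume in the space of all non-negative angle structures on $(N,\mathcal T)$. -/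

import Mathlib

noncomputable section

namespace IdealTriangulation

/-! ## Triangulations of closed pseudo 3-manifolds -/

/-- The edges of a tetrahedron with vertex set `Fin 4`: the two-element sets of vertices. -/
abbrev TetEdge : Type := {e : Finset (Fin 4) // e.card = 2}

/-- The edge of the tetrahedron with end points `i` and `j`. -/
def edge (i j : Fin 4) (h : i ≠ j) : TetEdge := ⟨{i, j}, Finset.card_pair h⟩

/-- The edge opposite to a given edge. -/
def TetEdge.opp (e : TetEdge) : TetEdge :=
  ⟨e.1ᶜ, by rw [Finset.card_compl, e.2]; rfl⟩

/-- The image of an edge under a bijection of the vertices. -/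
def TetEdge.map (g : Equiv.Perm (Fin 4)) (e : TetEdge) : TetEdge :=
  ⟨e.1.map g.toEmbedding, by rw [Finset.card_map, e.2]⟩

/-- A triangulated closed pseudo 3-manifold with set of tetrahedra `T`: a disjoint collection of
tetrahedra `σ : T`, each with vertices labelled by `Fin 4`, all of whose codimension-1 faces are
identified in pairs by affine homeomorphisms. The face of `σ` opposite to the vertex `i` is glued
to a face of `adj σ i`. An affine homeomorphism between triangles is the same thing as a bijection
between their vertices; it is recorded by the permutation `glue σ i` of `Fin 4` that extends
this bijection by sending the opposite vertex `i` to the vertex opposite to the target face. -/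
structure ClosedTriangulation (T : Type*) where
  /-- the tetrahedron to which the face of `σ` opposite to `i` is glued -/
  adj : T → Fin 4 → T
  /-- the gluing map of the face of `σ` opposite to `i` -/
  glue : T → Fin 4 → Equiv.Perm (Fin 4)
  /-- no face is glued to itself -/
  ne_self : ∀ σ i, (adj σ i, glue σ i i) ≠ (σ, i)
  /-- the faces are identified in pairs -/
  adj_adj : ∀ σ i, adj (adj σ i) (glue σ i i) = σ
  /-- the two gluing maps of a pair of faces are inverse to each other -/
  glue_glue : ∀ σ i, glue (adj σ i) (glue σ i i) = (glue σ i)⁻¹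

namespace ClosedTriangulation

variable {T : Type*} (τ : ClosedTriangulation T)

/-- The edge `x.2` of the tetrahedron `x.1` lies in a face whose gluing map sends it to the
edge `y.2` of the tetrahedron `y.1`. -/
def GluedEdges (x y : T × TetEdge) : Prop :=
  ∃ i : Fin 4, i ∉ x.2.1 ∧ y = (τ.adj x.1 i, x.2.map (τ.glue x.1 i))

/-- The edges of the triangulation: the classes of edges of tetrahedra under the equivalence
relation generated by the face gluings. -/
def Edge : Type _ := Quot τ.GluedEdges

/-- The edge of the triangulation on which the edge `e` of the tetrahedron `σ` lies. -/
def edgeOf (σ : T) (e : TetEdge) : τ.Edge := Quot.mk _ (σ, e)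

end ClosedTriangulation

/-! ## Angle structures and volume -/

/-- The Lobachevsky function. -/
def lobachevsky (x : ℝ) : ℝ := -∫ t in (0 : ℝ)..x, Real.log |2 * Real.sin t|

namespace ClosedTriangulation

variable {T : Type*} [Fintype T] (τ : ClosedTriangulation T)

open Classical in
/-- A non-negative angle structure: a non-negative number for each edge of each tetrahedron, such
that the angles around each edge of the triangulation add up to `2π` (an edge of the triangulation
that occurs several times in one tetrahedron is counted as often as it occurs) and the angles at
the three edges from each vertex of each tetrahedron add up to `π`. -/
structure IsNonnegAngleStructure (α : T → TetEdge → ℝ) : Prop where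
  nonneg : ∀ σ e, 0 ≤ α σ e
  edge_sum : ∀ c : τ.Edge,
    ∑ x : T × TetEdge with τ.edgeOf x.1 x.2 = c, α x.1 x.2 = 2 * Real.pi
  vertex_sum : ∀ (σ : T) (v : Fin 4), ∑ e : TetEdge with v ∈ e.1, α σ e = Real.pi

/-- A positive angle structure. -/
def IsPosAngleStructure (α : T → TetEdge → ℝ) : Prop :=
  τ.IsNonnegAngleStructure α ∧ ∀ σ e, 0 < α σ e

end ClosedTriangulation

/-- The volume of an angle structure: the sum over all tetrahedra of half the sum of the values of
the Lobachevsky function at the six angles (opposite edges carry equal angles, so this is the sum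
over the three pairs of opposite edges). -/
def volume {T : Type*} [Fintype T] (α : T → TetEdge → ℝ) : ℝ :=
  ∑ σ : T, (1 / 2) * ∑ e : TetEdge, lobachevsky (α σ e)

/-- `α` is a non-negative angle structure of maximal volume among all of them. -/
def ClosedTriangulation.IsVolumeMaximizer {T : Type*} [Fintype T] (τ : ClosedTriangulation T)
    (α : T → TetEdge → ℝ) : Prop :=
  τ.IsNonnegAngleStructure α ∧
    ∀ β : T → TetEdge → ℝ, τ.IsNonnegAngleStructure β → volume β ≤ volume α

/-! ## Decorated ideal tetrahedra in the hyperboloid model of hyperbolic 3-space -/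

/-- The Minkowski form of signature (3,1) on `ℝ⁴`. -/
def mink (x y : Fin 4 → ℝ) : ℝ := -(x 0 * y 0) + x 1 * y 1 + x 2 * y 2 + x 3 * y 3

/-- Hyperbolic 3-space, as the upper sheet of the hyperboloid. -/
def hyperbolicSpace : Set (Fin 4 → ℝ) := {x | mink x x = -1 ∧ 0 < x 0}

/-- The hyperbolic distance. -/
def hdist (x y : Fin 4 → ℝ) : ℝ := Real.arcosh (-mink x y)

/-- The future light cone. The rays in it are the points of the sphere at infinity. A vector `v` in
it stands for the ideal point given by its ray, together with the horosphere `horosphere v`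
centred there; multiplying `v` by positive numbers gives each horosphere centred at this ideal
point exactly once. -/
def lightCone : Set (Fin 4 → ℝ) := {v | mink v v = 0 ∧ 0 < v 0}

/-- The horosphere determined by a vector of the light cone. -/
def horosphere (v : Fin 4 → ℝ) : Set (Fin 4 → ℝ) := {x ∈ hyperbolicSpace | mink x v = -1}

/-- The complete geodesic between the ideal points given by `u` and `v`. -/
def geodesic (u v : Fin 4 → ℝ) : Set (Fin 4 → ℝ) :=
  {x ∈ hyperbolicSpace | ∃ a b : ℝ, 0 < a ∧ 0 < b ∧ x = a • u + b • v}

/-- `ℓ` is the signed length of the decorated edge from `u` to `v`: its absolute value is the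
distance between the points where the edge meets the two horospheres, and it is positive if the
horospheres are disjoint and non-positive if they meet. -/
def IsSignedLength (u v : Fin 4 → ℝ) (ℓ : ℝ) : Prop :=
  (∃ p ∈ horosphere u ∩ geodesic u v, ∃ q ∈ horosphere v ∩ geodesic u v, |ℓ| = hdist p q) ∧
    (0 < ℓ ↔ Disjoint (horosphere u) (horosphere v))

/-- `w` is the unit vector that, at the points of the geodesic between the ideal points `u` and `v`,
is tangent to hyperbolic space, orthogonal to this geodesic, and points into the
half-plane bounded by this geodesic that has `x` in its ideal boundary. -/
def IsFaceDirection (u v x w : Fin 4 → ℝ) : Prop :=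
  (∃ a b c : ℝ, 0 < c ∧ w = a • u + b • v + c • x) ∧
    mink w u = 0 ∧ mink w v = 0 ∧ mink w w = 1

/-- `θ` is the dihedral angle, along the geodesic between the ideal points `u` and `v`, of the two
half-planes bounded by this geodesic that have `x` and `y`, respectively, in their ideal
boundaries. -/
def IsDihedralAngle (u v x y : Fin 4 → ℝ) (θ : ℝ) : Prop :=
  ∃ w w' : Fin 4 → ℝ, IsFaceDirection u v x w ∧ IsFaceDirection u v y w' ∧
    θ = Real.arccos (mink w w')

/-- A decorated ideal tetrahedron: four decorated ideal points that do not lie on a round circle in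
the sphere at infinity. Round circles are the sections of the light cone by linear hyperplanes, so
this says that the four vectors are linearly independent. -/
structure DecoratedIdealTetrahedron where
  vert : Fin 4 → Fin 4 → ℝ
  mem_lightCone : ∀ i, vert i ∈ lightCone
  linearIndependent : LinearIndependent ℝ vert

/-- The decorated ideal tetrahedron has the (signed) edge lengths `l`. -/
def DecoratedIdealTetrahedron.HasLengths (D : DecoratedIdealTetrahedron) (l : TetEdge → ℝ) : Prop :=
  ∀ (i j : Fin 4) (h : i ≠ j), IsSignedLength (D.vert i) (D.vert j) (l (edge i j h))

/-- The decorated ideal tetrahedron has the dihedral angles `a`: the angle at the edge `ij` is the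
one between the faces `ijk` and `ijm`, where `k` and `m` are the other two vertices. -/
def DecoratedIdealTetrahedron.HasDihedralAngles (D : DecoratedIdealTetrahedron)
    (a : TetEdge → ℝ) : Prop :=
  ∀ (i j k m : Fin 4) (h : i ≠ j), i ≠ k → i ≠ m → j ≠ k → j ≠ m → k ≠ m →
    IsDihedralAngle (D.vert i) (D.vert j) (D.vert k) (D.vert m) (a (edge i j h))

/-- `a` are the dihedral angles of the decorated ideal tetrahedron of edge lengths `l`. -/
def AreAnglesOfLengths (l a : TetEdge → ℝ) : Prop :=
  ∃ D : DecoratedIdealTetrahedron, D.HasLengths l ∧ D.HasDihedralAngles a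

/-- The six angles `a` of a tetrahedron are `0, 0, 0, 0, π, π`, and
`e^((l₁ + l₄)/2) ≥ e^((l₂ + l₅)/2) + e^((l₃ + l₆)/2)`, where `l₁` is the length of an edge
of angle `π` and `lᵢ`, `lᵢ₊₃` are the lengths of opposite edges. -/
def IsFlatWithLengths (l a : TetEdge → ℝ) : Prop :=
  ∃ e₁ e₂ e₃ : TetEdge, e₂ ≠ e₃ ∧ e₂ ≠ e₃.opp ∧
    a e₁ = Real.pi ∧ a e₁.opp = Real.pi ∧
    a e₂ = 0 ∧ a e₂.opp = 0 ∧ a e₃ = 0 ∧ a e₃.opp = 0 ∧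
    Real.exp ((l e₁ + l e₁.opp) / 2) ≥
      Real.exp ((l e₂ + l e₂.opp) / 2) + Real.exp ((l e₃ + l e₃.opp) / 2)

/-- The lengths `l` on the edges of the triangulation induce the angles `α`: (1) for each
tetrahedron with all angles positive, its angles are the dihedral angles of the decorated ideal
tetrahedron with edge lengths given by `l`; (2) each tetrahedron with some angle zero has angles
`0, 0, 0, 0, π, π` and satisfies the above inequality. -/
def ClosedTriangulation.Induces {T : Type*} (τ : ClosedTriangulation T) (l : τ.Edge → ℝ)
    (α : T → TetEdge → ℝ) : Prop :=
  ∀ σ : T,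
    ((∀ e, 0 < α σ e) → AreAnglesOfLengths (fun e => l (τ.edgeOf σ e)) (α σ)) ∧
    ((∃ e, α σ e = 0) → IsFlatWithLengths (fun e => l (τ.edgeOf σ e)) (α σ))

end IdealTriangulation

end

namespace IdealTriangulation

open Set Filter Topology

/-! ## The Lobachevsky function -/

/-! The theorem is Lagrange duality for a concave maximization problem with linear constraints, in
which the lengths are the multipliers. Opposite angles agree, so an angle structure is a family of
points of `angleSimplex`, one per tetrahedron, subject to one linear equation per edge of the
triangulation. If the edge `c` has multiplier `l c / 2`, then regrouping the multiplier terms by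
tetrahedra (`sum_mul_edgeSum`) turns the Lagrangian, up to a constant, into a sum of independent
functions `energy`, one per tetrahedron, with coefficients the half sums of the lengths of opposite
edges (`sum_energy_eq`).

On one simplex the maximizer of `energy L` is exactly the triple satisfying `IsBalanced L`: the
angles of the Euclidean triangle with sides `exp (L i)`, or `0, 0, π` when the strict triangle
inequality fails. One-sided first variations show that a maximizer is balanced
(`isBalanced_of_isMaxOn`); the laws of sines and cosines show that a balanced triple is unique;
compactness then gives the converse (`IsBalanced.isMaxOn`). Concavity of the volume is a
consequence.

Given a volume maximizer, the positive angle structure is a Slater point, so multipliers exist by a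
separation argument (`exists_lagrange_multiplier`), and each tetrahedron maximizes its own energy.
Conversely, if each tetrahedron is balanced, adding up the energies gives weak duality.

What remains is hyperbolic geometry. In the hyperboloid model a length `ℓ` means that the Minkowski
product of the two light-like vectors is `-2 exp ℓ`. A computation with these products shows that
the dihedral angles are those of the Euclidean triangle with sides `exp` of the half sums
(`isDihedralAngle_iff`), and an explicit configuration realizes all lengths needed
(`areAnglesOfLengths_of_log_sin`). -/

theorem intervalIntegrable_log_abs_two_mul_sin (a b : ℝ) :
    IntervalIntegrable (fun t => Real.log |2 * Real.sin t|) MeasureTheory.volume a b := by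
  have h : MeromorphicOn (fun t : ℝ => 2 * Real.sin t) (uIcc a b) := by
    intro x _
    have : AnalyticAt ℝ (fun t : ℝ => 2 * Real.sin t) x := by fun_prop
    exact this.meromorphicAt
  simpa [Real.norm_eq_abs] using h.intervalIntegrable_log_norm

theorem continuous_lobachevsky : Continuous lobachevsky :=
  (intervalIntegral.continuous_primitive intervalIntegrable_log_abs_two_mul_sin 0).neg

theorem hasDerivAt_lobachevsky {x : ℝ} (hx : 0 < Real.sin x) :
    HasDerivAt lobachevsky (-Real.log (2 * Real.sin x)) x := by
  have hc : ContinuousAt (fun t => Real.log |2 * Real.sin t|) x := by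
    refine ContinuousAt.log (by fun_prop) ?_
    simpa using hx.ne'
  have hm : StronglyMeasurableAtFilter (fun t => Real.log |2 * Real.sin t|) (𝓝 x) := by
    have : Measurable fun t => Real.log |2 * Real.sin t| := by fun_prop
    exact this.stronglyMeasurable.stronglyMeasurableAtFilter
  have h := (intervalIntegral.integral_hasDerivAt_right
    (intervalIntegrable_log_abs_two_mul_sin 0 x) hm hc).neg
  rwa [abs_of_pos (by positivity)] at h

/-! ## The energy of the three angles of a tetrahedron -/

/-- The triples of non-negative numbers with sum `π`. -/
def angleSimplex : Set (Fin 3 → ℝ) := {a | (∀ i, 0 ≤ a i) ∧ ∑ i, a i = Real.pi}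

/-- The volume of an ideal tetrahedron with angles `a`, plus a linear term. -/
noncomputable def energy (L a : Fin 3 → ℝ) : ℝ := ∑ i, (lobachevsky (a i) + L i * a i)

/-- The angles `a` are those of a triangle of side lengths `exp ∘ L`, where a triangle that
violates the strict triangle inequality is given the angles `0, 0, π`. -/
def IsBalanced (L a : Fin 3 → ℝ) : Prop :=
  ((∀ i, 0 < a i) ∧ ∃ k, ∀ i, L i = Real.log (Real.sin (a i)) + k) ∨
  ∃ i j k, i ≠ j ∧ i ≠ k ∧ j ≠ k ∧ a i = Real.pi ∧ a j = 0 ∧ a k = 0 ∧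
    Real.exp (L j) + Real.exp (L k) ≤ Real.exp (L i)

theorem sum_fin_three {i j k : Fin 3} (hij : i ≠ j) (hik : i ≠ k) (hjk : j ≠ k) (f : Fin 3 → ℝ) :
    ∑ x, f x = f i + f j + f k := by
  have : (Finset.univ : Finset (Fin 3)) = {i, j, k} := by
    revert i j k; decide
  rw [this, Finset.sum_insert (by simp [hij, hik]), Finset.sum_insert (by simp [hjk]),
    Finset.sum_singleton, add_assoc]

theorem eq_or_eq_or_eq {i j k : Fin 3} (hij : i ≠ j) (hik : i ≠ k) (hjk : j ≠ k) (x : Fin 3) :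
    x = i ∨ x = j ∨ x = k := by
  revert i j k x; decide

theorem exists_third (i j : Fin 3) (h : i ≠ j) : ∃ k, i ≠ k ∧ j ≠ k := by
  revert i j; decide

theorem exists_others (i : Fin 3) : ∃ j k, i ≠ j ∧ i ≠ k ∧ j ≠ k := by
  revert i; decide

theorem continuous_energy (L : Fin 3 → ℝ) : Continuous (energy L) := by
  unfold energy
  have := continuous_lobachevsky
  fun_prop

theorem lt_pi_of_pos {a : Fin 3 → ℝ} (ha : ∀ i, 0 < a i) (hs : ∑ i, a i = Real.pi) (i : Fin 3) :
    a i < Real.pi := by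
  obtain ⟨j, k, hij, hik, hjk⟩ := exists_others i
  rw [sum_fin_three hij hik hjk] at hs
  linarith [ha j, ha k]

theorem sin_pos_of_pos {a : Fin 3 → ℝ} (ha : ∀ i, 0 < a i) (hs : ∑ i, a i = Real.pi)
    (i : Fin 3) : 0 < Real.sin (a i) :=
  Real.sin_pos_of_pos_of_lt_pi (ha i) (lt_pi_of_pos ha hs i)

theorem isCompact_angleSimplex : IsCompact angleSimplex := by
  have hc : IsClosed angleSimplex := by
    have : angleSimplex = (⋂ i, {a | 0 ≤ a i}) ∩ {a | ∑ i, a i = Real.pi} := by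
      ext a; simp [angleSimplex]
    rw [this]
    refine (isClosed_iInter fun i => isClosed_le continuous_const (by fun_prop)).inter
      (isClosed_eq (by fun_prop) continuous_const)
  refine (isCompact_Icc (a := (0 : Fin 3 → ℝ)) (b := fun _ => Real.pi)).of_isClosed_subset hc ?_
  intro a ha
  refine ⟨fun i => ha.1 i, fun i => ?_⟩
  rw [← ha.2]
  exact Finset.single_le_sum (f := a) (fun j _ => ha.1 j) (Finset.mem_univ i)

/-- Mean value theorem. Differentiability is required only to the right of `0`: the paths used below
may start on the boundary of the simplex, where the Lobachevsky function has infinite slope. -/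
theorem exists_gt_of_deriv_pos {g g' : ℝ → ℝ} (hc : Continuous g)
    (hd : ∀ᶠ t in 𝓝[>] (0 : ℝ), HasDerivAt g (g' t) t) (hpos : ∀ᶠ t in 𝓝[>] (0 : ℝ), 0 < g' t)
    {p : ℝ → Prop} (hp : ∀ᶠ t in 𝓝[>] (0 : ℝ), p t) :
    ∃ t, p t ∧ g 0 < g t := by
  obtain ⟨ε, hε, h⟩ := mem_nhdsGT_iff_exists_Ioo_subset.1 (hd.and (hpos.and hp))
  have hε : 0 < ε := hε
  have hsub : ∀ t ∈ Ioo 0 (ε / 2), t ∈ Ioo 0 ε := fun t ht => ⟨ht.1, by linarith [ht.2]⟩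
  obtain ⟨c, hc', hs⟩ := exists_hasDerivAt_eq_slope g g' (half_pos hε) hc.continuousOn
    (fun t ht => (h (hsub t ht)).1)
  refine ⟨ε / 2, (h ⟨half_pos hε, by linarith⟩).2.2, ?_⟩
  have := (h (hsub c hc')).2.1
  rw [hs, sub_zero, div_pos_iff_of_pos_right (half_pos hε)] at this
  linarith

/-- First variation: the sum in the conclusion is the derivative of the energy along `a + t • v`, a
path that enters the interior of the simplex. -/
theorem not_eventually_pos_of_isMaxOn {L a v : Fin 3 → ℝ} (ha : a ∈ angleSimplex)
    (hmax : IsMaxOn (energy L) angleSimplex a) (hv : ∑ i, v i = 0)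
    (hev : ∀ᶠ t in 𝓝[>] (0 : ℝ), ∀ i, 0 < a i + t * v i) :
    ¬ ∀ᶠ t in 𝓝[>] (0 : ℝ),
      0 < ∑ i, v i * (L i - Real.log (2 * Real.sin (a i + t * v i))) := by
  intro hpos
  have hsum : ∀ t : ℝ, ∑ i, (a i + t * v i) = Real.pi := by
    intro t
    rw [Finset.sum_add_distrib, ← Finset.mul_sum, hv, ha.2]; ring
  obtain ⟨t, ht, hlt⟩ := exists_gt_of_deriv_pos (g := fun t => energy L fun i => a i + t * v i)
    (g' := fun t => ∑ i, v i * (L i - Real.log (2 * Real.sin (a i + t * v i))))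
    ((continuous_energy L).comp (by fun_prop)) (by
      filter_upwards [hev] with t ht
      unfold energy
      refine HasDerivAt.fun_sum fun i _ => ?_
      have h1 : HasDerivAt (fun t : ℝ => a i + t * v i) (v i) t := by
        simpa using ((hasDerivAt_id t).mul_const (v i)).const_add (a i)
      have h2 := (hasDerivAt_lobachevsky (sin_pos_of_pos ht (hsum t) i)).comp t h1
      have h3 := h2.add (h1.const_mul (L i))
      exact h3.congr_deriv (by ring)) hpos hev
  have hmem : (fun i => a i + t * v i) ∈ angleSimplex := ⟨fun i => (ht i).le, hsum t⟩
  have h1 : energy L (fun i => a i + t * v i) ≤ energy L a := hmax hmem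
  simp only [zero_mul, add_zero] at hlt
  linarith

theorem tendsto_two_mul_sin_div (v : ℝ) :
    Tendsto (fun t : ℝ => 2 * Real.sin (t * v) / t) (𝓝[>] 0) (𝓝 (2 * v)) := by
  have h : HasDerivAt (fun t : ℝ => 2 * Real.sin (t * v)) (2 * v) 0 := by
    have h1 : HasDerivAt (fun t : ℝ => t * v) v 0 := by
      simpa using (hasDerivAt_id (0 : ℝ)).mul_const v
    have := (h1.sin).const_mul 2
    simpa using this
  have h2 := (hasDerivAt_iff_tendsto_slope.1 h).mono_left
    (nhdsWithin_mono 0 (fun t (ht : 0 < t) => ht.ne'))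
  refine h2.congr fun t => ?_
  simp [slope_def_field]

theorem eventually_pos_add_mul {x : ℝ} (hx : 0 < x) (v : ℝ) :
    ∀ᶠ t in 𝓝[>] (0 : ℝ), 0 < x + t * v := by
  have h : Tendsto (fun t : ℝ => x + t * v) (𝓝[>] 0) (𝓝 x) := by
    have : Continuous fun t : ℝ => x + t * v := by fun_prop
    simpa using (this.tendsto 0).mono_left nhdsWithin_le_nhds
  exact h.eventually_const_lt hx

theorem isBalanced_of_isMaxOn_of_pos {L a : Fin 3 → ℝ} (ha : a ∈ angleSimplex)
    (hmax : IsMaxOn (energy L) angleSimplex a) (hpos : ∀ i, 0 < a i) : IsBalanced L a := by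
  have key : ∀ i j, i ≠ j →
      L i - Real.log (2 * Real.sin (a i)) ≤ L j - Real.log (2 * Real.sin (a j)) := by
    intro i j hij
    by_contra! hlt
    obtain ⟨k, hik, hjk⟩ := exists_third i j hij
    -- If the inequality fails, shifting angle from `j` to `i` increases the energy.
    let v : Fin 3 → ℝ := fun x => if x = i then 1 else if x = j then -1 else 0
    have hvi : v i = 1 := by simp [v]
    have hvj : v j = -1 := by simp [v, hij.symm]
    have hvk : v k = 0 := by simp [v, hik.symm, hjk.symm]
    refine not_eventually_pos_of_isMaxOn (v := v) ha hmax ?_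
      (eventually_all.2 fun x => eventually_pos_add_mul (hpos x) _) ?_
    · rw [sum_fin_three hij hik hjk, hvi, hvj, hvk]; ring
    · have hT : Tendsto (fun t : ℝ => ∑ x, v x * (L x - Real.log (2 * Real.sin (a x + t * v x))))
          (𝓝[>] 0) (𝓝 (∑ x, v x * (L x - Real.log (2 * Real.sin (a x + 0 * v x))))) := by
        refine Tendsto.mono_left ?_ nhdsWithin_le_nhds
        refine ContinuousAt.tendsto (x := (0 : ℝ)) (f := fun t : ℝ =>
          ∑ x, v x * (L x - Real.log (2 * Real.sin (a x + t * v x)))) ?_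
        refine tendsto_finsetSum _ fun x _ => ?_
        refine ContinuousAt.mul continuousAt_const (continuousAt_const.sub ?_)
        refine ContinuousAt.log (by fun_prop) ?_
        have := sin_pos_of_pos hpos ha.2 x
        simp [this.ne']
      refine hT.eventually_const_lt ?_
      rw [sum_fin_three hij hik hjk, hvi, hvj, hvk]
      simp only [zero_mul, add_zero]
      linarith
  refine Or.inl ⟨hpos, L 0 - Real.log (Real.sin (a 0)), fun i => ?_⟩
  have heq : L i - Real.log (2 * Real.sin (a i)) = L 0 - Real.log (2 * Real.sin (a 0)) := by
    by_cases h : i = 0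
    · rw [h]
    · exact le_antisymm (key _ _ h) (key _ _ (Ne.symm h))
  rw [Real.log_mul two_ne_zero (sin_pos_of_pos hpos ha.2 i).ne',
    Real.log_mul two_ne_zero (sin_pos_of_pos hpos ha.2 0).ne'] at heq
  linarith

/-- In the direction `(2, -1, -1)` the vanishing angle contributes `-2 log (2 sin 2t)`, which tends
to `+∞`, to the derivative. The other two terms stay bounded because those angles lie strictly
between `0` and `π`. -/
theorem not_isMaxOn_of_one_zero {L a : Fin 3 → ℝ} (ha : a ∈ angleSimplex) {i j k : Fin 3}
    (hij : i ≠ j) (hik : i ≠ k) (hjk : j ≠ k) (hi : a i = 0) (hj : 0 < a j) (hk : 0 < a k) :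
    ¬ IsMaxOn (energy L) angleSimplex a := by
  intro hmax
  let v : Fin 3 → ℝ := fun x => if x = i then 2 else -1
  have hvi : v i = 2 := by simp [v]
  have hvj : v j = -1 := by simp [v, hij.symm]
  have hvk : v k = -1 := by simp [v, hik.symm]
  have hsum := ha.2
  rw [sum_fin_three hij hik hjk, hi] at hsum
  refine not_eventually_pos_of_isMaxOn (v := v) ha hmax ?_ ?_ ?_
  · rw [sum_fin_three hij hik hjk, hvi, hvj, hvk]; ring
  · refine eventually_all.2 fun x => ?_
    by_cases hx : x = i
    · subst hx
      rw [hi, hvi]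
      filter_upwards [self_mem_nhdsWithin] with t ht
      have : 0 < t := ht
      linarith
    · refine eventually_pos_add_mul ?_ _
      rcases (eq_or_eq_or_eq hij hik hjk x).resolve_left hx with rfl | rfl <;> assumption
  · have hother : ∀ x, 0 < a x → a x < Real.pi → Tendsto
        (fun t : ℝ => (-1) * (L x - Real.log (2 * Real.sin (a x + t * (-1))))) (𝓝[>] 0)
        (𝓝 ((-1) * (L x - Real.log (2 * Real.sin (a x + 0 * (-1)))))) := by
      intro x hx hx'
      refine Tendsto.mono_left ?_ nhdsWithin_le_nhds
      refine ContinuousAt.tendsto (x := (0 : ℝ)) (f := fun t : ℝ =>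
        (-1) * (L x - Real.log (2 * Real.sin (a x + t * (-1))))) ?_
      refine ContinuousAt.mul continuousAt_const (continuousAt_const.sub ?_)
      refine ContinuousAt.log (by fun_prop) ?_
      have := Real.sin_pos_of_pos_of_lt_pi hx hx'
      simp [this.ne']
    have hmain : Tendsto (fun t : ℝ => 2 * (L i - Real.log (2 * Real.sin (0 + t * 2))))
        (𝓝[>] 0) atTop := by
      refine Tendsto.const_mul_atTop two_pos ?_
      refine tendsto_atTop_add_const_left _ _ ?_
      refine tendsto_neg_atBot_atTop.comp (Real.tendsto_log_nhdsGT_zero.comp ?_)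
      refine tendsto_nhdsWithin_iff.2 ⟨?_, ?_⟩
      · have : Continuous fun t : ℝ => 2 * Real.sin (0 + t * 2) := by fun_prop
        simpa using (this.tendsto 0).mono_left nhdsWithin_le_nhds
      · filter_upwards [Ioo_mem_nhdsGT (show (0 : ℝ) < 1 by norm_num)] with t ht
        have := Real.sin_pos_of_pos_of_lt_pi (x := 0 + t * 2) (by linarith [ht.1])
          (by linarith [ht.2, Real.pi_gt_three])
        simpa using this
    have hT := (hmain.atTop_add (hother j hj (by linarith))).atTop_add (hother k hk (by linarith))
    filter_upwards [hT.eventually_gt_atTop 0] with t ht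
    rw [sum_fin_three hij hik hjk, hvi, hvj, hvk, hi]
    exact ht

/-- At a vertex of the simplex the logarithmic singularities cancel, so the derivative has a finite
limit. Opening the two zero angles at the rates `p = exp (L j)` and `q = exp (L k)` makes this limit
`(p + q) * (log (p + q) - L i)`, which is positive exactly when the inequality fails. -/
theorem exp_add_exp_le_of_isMaxOn {L a : Fin 3 → ℝ} (ha : a ∈ angleSimplex) {i j k : Fin 3}
    (hij : i ≠ j) (hik : i ≠ k) (hjk : j ≠ k) (hi : a i = Real.pi) (hj : a j = 0) (hk : a k = 0)
    (hmax : IsMaxOn (energy L) angleSimplex a) :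
    Real.exp (L j) + Real.exp (L k) ≤ Real.exp (L i) := by
  by_contra! hlt
  set p := Real.exp (L j) with hp
  set q := Real.exp (L k) with hq
  have hp0 : 0 < p := Real.exp_pos _
  have hq0 : 0 < q := Real.exp_pos _
  let v : Fin 3 → ℝ := fun x => if x = j then p else if x = k then q else -(p + q)
  have hvj : v j = p := by simp [v]
  have hvk : v k = q := by simp [v, hjk.symm]
  have hvi : v i = -(p + q) := by simp [v, hij, hik]
  refine not_eventually_pos_of_isMaxOn (v := v) ha hmax ?_ ?_ ?_
  · rw [sum_fin_three hij hik hjk, hvi, hvj, hvk]; ring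
  · refine eventually_all.2 fun x => ?_
    rcases eq_or_eq_or_eq hij hik hjk x with rfl | rfl | rfl
    · rw [hi]; exact eventually_pos_add_mul Real.pi_pos _
    · rw [hj, hvj]
      filter_upwards [self_mem_nhdsWithin] with t ht
      have : 0 < t := ht
      positivity
    · rw [hk, hvk]
      filter_upwards [self_mem_nhdsWithin] with t ht
      have : 0 < t := ht
      positivity
  -- Dividing each sine by `t` does not change the derivative: the weights `p`, `q`, `-(p + q)` add
  -- up to zero, so the terms `log t` cancel.
  · have hl : ∀ w : ℝ, 0 < w → Tendsto (fun t : ℝ => Real.log (2 * Real.sin (t * w) / t)) (𝓝[>] 0)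
        (𝓝 (Real.log (2 * w))) := fun w hw =>
      (tendsto_two_mul_sin_div w).log (by positivity)
    have hT := (((hl p hp0).const_sub (L j)).const_mul p).add
      ((((hl q hq0).const_sub (L k)).const_mul q).sub
        (((hl (p + q) (by positivity)).const_sub (L i)).const_mul (p + q)))
    have hlim : 0 < p * (L j - Real.log (2 * p)) + (q * (L k - Real.log (2 * q)) -
        (p + q) * (L i - Real.log (2 * (p + q)))) := by
      have h1 : L i < Real.log (p + q) := (Real.lt_log_iff_exp_lt (by positivity)).2 hlt
      have h2 : Real.log p = L j := Real.log_exp _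
      have h3 : Real.log q = L k := Real.log_exp _
      rw [Real.log_mul two_ne_zero hp0.ne', Real.log_mul two_ne_zero hq0.ne',
        Real.log_mul two_ne_zero (by positivity), h2, h3]
      have : 0 < (p + q) * (Real.log (p + q) - L i) :=
        mul_pos (by positivity) (by linarith)
      linarith
    filter_upwards [hT.eventually_const_lt hlim,
      Ioo_mem_nhdsGT (show (0 : ℝ) < Real.pi / (p + q) by positivity)] with t ht htm
    have ht0 : 0 < t := htm.1
    have htb : t * (p + q) < Real.pi := (lt_div_iff₀ (by positivity)).1 htm.2
    have hs : ∀ w, 0 < w → w ≤ p + q → Real.log (2 * Real.sin (t * w) / t) =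
        Real.log (2 * Real.sin (t * w)) - Real.log t := by
      intro w hw hw'
      have : 0 < Real.sin (t * w) := Real.sin_pos_of_pos_of_lt_pi (by positivity)
        (lt_of_le_of_lt (mul_le_mul_of_nonneg_left hw' ht0.le) htb)
      rw [Real.log_div (by positivity) ht0.ne']
    rw [hs p hp0 (by linarith), hs q hq0 (by linarith), hs (p + q) (by linarith) le_rfl] at ht
    rw [sum_fin_three hij hik hjk, hvi, hvj, hvk, hi, hj, hk, zero_add, zero_add,
      show Real.pi + t * -(p + q) = Real.pi - t * (p + q) by ring, Real.sin_pi_sub]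
    refine ht.trans_eq ?_
    ring

theorem isBalanced_of_isMaxOn {L a : Fin 3 → ℝ} (ha : a ∈ angleSimplex)
    (hmax : IsMaxOn (energy L) angleSimplex a) : IsBalanced L a := by
  by_cases hpos : ∀ i, 0 < a i
  · exact isBalanced_of_isMaxOn_of_pos ha hmax hpos
  push Not at hpos
  obtain ⟨i, hi⟩ := hpos
  have hi : a i = 0 := le_antisymm hi (ha.1 i)
  obtain ⟨j, k, hij, hik, hjk⟩ := exists_others i
  have hsum := ha.2
  rw [sum_fin_three hij hik hjk, hi, zero_add] at hsum
  rcases (ha.1 j).eq_or_lt' with hj | hj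
  · have hk : a k = Real.pi := by linarith
    exact Or.inr ⟨k, i, j, hik.symm, hjk.symm, hij, hk, hi, hj,
      exp_add_exp_le_of_isMaxOn ha hik.symm hjk.symm hij hk hi hj hmax⟩
  rcases (ha.1 k).eq_or_lt' with hk | hk
  · have hj : a j = Real.pi := by linarith
    exact Or.inr ⟨j, i, k, hij.symm, hjk, hik, hj, hi, hk,
      exp_add_exp_le_of_isMaxOn ha hij.symm hjk hik hj hi hk hmax⟩
  exact absurd hmax (not_isMaxOn_of_one_zero ha hij hik hjk hi hj hk)

/-! ## Triangles are determined by their side lengths -/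

/-- Law of cosines in the triangle of circumdiameter `1`, whose sides are the sines of its angles.
-/
theorem cos_eq_of_sum_eq_pi {x y z : ℝ} (h : x + y + z = Real.pi) :
    2 * Real.sin y * Real.sin z * Real.cos x =
      Real.sin y ^ 2 + Real.sin z ^ 2 - Real.sin x ^ 2 := by
  have hx : x = Real.pi - (y + z) := by linarith
  rw [hx, Real.cos_pi_sub, Real.sin_pi_sub, Real.cos_add, Real.sin_add]
  have h1 := Real.sin_sq_add_cos_sq y
  have h2 := Real.sin_sq_add_cos_sq z
  linear_combination (Real.sin z ^ 2) * h1 + (Real.sin y ^ 2) * h2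

theorem sin_lt_sin_add_sin {x y z : ℝ} (hx : 0 < x) (hy : 0 < y) (hz : 0 < z)
    (h : x + y + z = Real.pi) : Real.sin x < Real.sin y + Real.sin z := by
  have hx' : x = Real.pi - (y + z) := by linarith
  rw [hx', Real.sin_pi_sub, Real.sin_add]
  have h1 : 0 < Real.sin y := Real.sin_pos_of_pos_of_lt_pi hy (by linarith)
  have h2 : 0 < Real.sin z := Real.sin_pos_of_pos_of_lt_pi hz (by linarith)
  have h3 : Real.cos y < 1 := by
    rw [← Real.cos_zero]; exact Real.cos_lt_cos_of_nonneg_of_le_pi le_rfl (by linarith) hy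
  have h4 : Real.cos z < 1 := by
    rw [← Real.cos_zero]; exact Real.cos_lt_cos_of_nonneg_of_le_pi le_rfl (by linarith) hz
  nlinarith

/-- The two triples of sines are proportional, so the law of cosines gives the same cosines:
triangles with proportional sides are similar. -/
theorem eq_of_log_sin {L a b : Fin 3 → ℝ} (ha : ∀ i, 0 < a i) (hb : ∀ i, 0 < b i)
    (has : ∑ i, a i = Real.pi) (hbs : ∑ i, b i = Real.pi) {k k' : ℝ}
    (hk : ∀ i, L i = Real.log (Real.sin (a i)) + k)
    (hk' : ∀ i, L i = Real.log (Real.sin (b i)) + k') : a = b := by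
  have hr : ∀ i, Real.sin (b i) = Real.exp (k - k') * Real.sin (a i) := by
    intro i
    have h1 := sin_pos_of_pos ha has i
    have h2 := sin_pos_of_pos hb hbs i
    rw [← Real.exp_log h2, ← Real.exp_log h1, ← Real.exp_add]
    congr 1
    linarith [hk i, hk' i]
  set r := Real.exp (k - k')
  have hr0 : 0 < r := Real.exp_pos _
  funext i
  obtain ⟨j, l, hij, hil, hjl⟩ := exists_others i
  have h1 := has
  have h2 := hbs
  rw [sum_fin_three hij hil hjl] at h1 h2
  have c1 := cos_eq_of_sum_eq_pi h1
  have c2 := cos_eq_of_sum_eq_pi h2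
  rw [hr i, hr j, hr l] at c2
  have s1 := sin_pos_of_pos ha has j
  have s2 := sin_pos_of_pos ha has l
  have : r ^ 2 * (2 * Real.sin (a j) * Real.sin (a l)) * (Real.cos (a i) - Real.cos (b i)) = 0 := by
    linear_combination r ^ 2 * c1 - c2
  have hne : r ^ 2 * (2 * Real.sin (a j) * Real.sin (a l)) ≠ 0 := by positivity
  refine Real.injOn_cos ⟨(ha i).le, (lt_pi_of_pos ha has i).le⟩
    ⟨(hb i).le, (lt_pi_of_pos hb hbs i).le⟩ ?_
  have := (mul_eq_zero.1 this).resolve_left hne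
  linarith

theorem exp_lt_exp_add_exp {L a : Fin 3 → ℝ} (ha : ∀ i, 0 < a i) (has : ∑ i, a i = Real.pi)
    {c : ℝ} (hc : ∀ i, L i = Real.log (Real.sin (a i)) + c) {i j k : Fin 3}
    (hij : i ≠ j) (hik : i ≠ k) (hjk : j ≠ k) :
    Real.exp (L i) < Real.exp (L j) + Real.exp (L k) := by
  have hs := has
  rw [sum_fin_three hij hik hjk] at hs
  rw [hc i, hc j, hc k, Real.exp_add, Real.exp_add, Real.exp_add,
    Real.exp_log (sin_pos_of_pos ha has i), Real.exp_log (sin_pos_of_pos ha has j),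
    Real.exp_log (sin_pos_of_pos ha has k), ← add_mul]
  exact mul_lt_mul_of_pos_right (sin_lt_sin_add_sin (ha i) (ha j) (ha k) hs) (Real.exp_pos c)

/-- A genuine triangle satisfies all strict triangle inequalities, which excludes the flat case. Two
flat triples with different angles `π` would each have a side strictly longer than the other's
longest one. -/
theorem IsBalanced.unique {L a b : Fin 3 → ℝ} (ha : a ∈ angleSimplex) (hb : b ∈ angleSimplex)
    (hLa : IsBalanced L a) (hLb : IsBalanced L b) : a = b := by
  rcases hLa with ⟨hap, k, hk⟩ | ⟨i, j, l, hij, hil, hjl, hi, hj, hl, hle⟩ <;>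
  rcases hLb with ⟨hbp, k', hk'⟩ | ⟨i', j', l', hij', hil', hjl', hi', hj', hl', hle'⟩
  · exact eq_of_log_sin hap hbp ha.2 hb.2 hk hk'
  · exact absurd hle' (not_le.2 (exp_lt_exp_add_exp hap ha.2 hk hij' hil' hjl'))
  · exact absurd hle (not_le.2 (exp_lt_exp_add_exp hbp hb.2 hk' hij hil hjl))
  · by_cases h : i = i'
    · subst h
      funext x
      by_cases hxi : x = i
      · rw [hxi, hi, hi']
      · have h1 : a x = 0 := by
          rcases (eq_or_eq_or_eq hij hil hjl x).resolve_left hxi with rfl | rfl <;> assumption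
        have h2 : b x = 0 := by
          rcases (eq_or_eq_or_eq hij' hil' hjl' x).resolve_left hxi with rfl | rfl <;> assumption
        rw [h1, h2]
    · exfalso
      have h1 : Real.exp (L i') < Real.exp (L i) := by
        rcases (eq_or_eq_or_eq hij hil hjl i').resolve_left (Ne.symm h) with rfl | rfl
        · linarith [Real.exp_pos (L l)]
        · linarith [Real.exp_pos (L j)]
      have h2 : Real.exp (L i) < Real.exp (L i') := by
        rcases (eq_or_eq_or_eq hij' hil' hjl' i).resolve_left h with rfl | rfl
        · linarith [Real.exp_pos (L l')]
        · linarith [Real.exp_pos (L j')]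
      exact lt_asymm h1 h2

/-- A maximizer exists by compactness and is balanced, so uniqueness identifies it with `a`. No
concavity is used. -/
theorem IsBalanced.isMaxOn {L a : Fin 3 → ℝ} (ha : a ∈ angleSimplex) (h : IsBalanced L a) :
    IsMaxOn (energy L) angleSimplex a := by
  obtain ⟨b, hb, hmax⟩ := isCompact_angleSimplex.exists_isMaxOn ⟨a, ha⟩
    (continuous_energy L).continuousOn
  rwa [h.unique ha hb (isBalanced_of_isMaxOn hb hmax)]

/-- The supporting hyperplane of the volume at a positive triple of angles. -/
theorem sum_lobachevsky_le {a b : Fin 3 → ℝ} (ha : ∀ i, 0 < a i) (has : ∑ i, a i = Real.pi)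
    (hb : b ∈ angleSimplex) :
    ∑ i, lobachevsky (b i) ≤ ∑ i, lobachevsky (a i) -
      ∑ i, Real.log (Real.sin (a i)) * (b i - a i) := by
  -- With these coefficients `a` is balanced by construction; its maximality is the inequality
  -- sought.
  have h : IsBalanced (fun i => Real.log (Real.sin (a i))) a :=
    Or.inl ⟨ha, 0, fun i => by simp⟩
  have h1 : energy _ b ≤ energy _ a := h.isMaxOn ⟨fun i => (ha i).le, has⟩ hb
  simp only [energy, Finset.sum_add_distrib] at h1
  simp only [mul_sub, Finset.sum_sub_distrib]
  linarith

/-! ## Lagrange multipliers -/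

/-- Strong duality: under Slater's condition, a concave maximization problem with linear
constraints has a vector of Lagrange multipliers. -/
theorem exists_lagrange_multiplier {Y ι : Type*} [NormedAddCommGroup Y] [NormedSpace ℝ Y]
    [Fintype ι] {D : Set Y} (hD : IsOpen D) {F : Y → ℝ} (hF : ConcaveOn ℝ D F)
    (hFc : ContinuousOn F D) (A : ι → Y →ₗ[ℝ] ℝ) {m : ℝ} {v₀ : Y} (hv₀ : v₀ ∈ D)
    (hA : ∀ c, A c v₀ = 0) (hm : ∀ v ∈ D, (∀ c, A c v = 0) → F v ≤ m) :
    ∃ r : ι → ℝ, ∀ v ∈ D, F v + ∑ c, r c * A c v ≤ m := by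
  have hG : ConcaveOn ℝ D (fun v => F v + -m) := hF.add (concaveOn_const (-m) hF.1)
  have hUo : IsOpen {p : Y × ℝ | p.1 ∈ D ∧ p.2 < F p.1 + -m} := by
    have h1 : ContinuousOn (fun p : Y × ℝ => F p.1 + -m - p.2) (D ×ˢ univ) := by
      refine ContinuousOn.sub (ContinuousOn.add (hFc.comp continuousOn_fst fun p hp => hp.1)
        continuousOn_const) continuousOn_snd
    have h2 := h1.isOpen_inter_preimage (hD.prod isOpen_univ) (isOpen_Ioi (a := (0 : ℝ)))
    convert h2 using 1
    ext p
    simp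
  have htc : Convex ℝ {p : Y × ℝ | (∀ c, A c p.1 = 0) ∧ p.2 = 0} := by
    intro p hp q hq s t _ _ _
    refine ⟨fun c => ?_, ?_⟩
    · simp [hp.1 c, hq.1 c]
    · simp [hp.2, hq.2]
  have hdisj : Disjoint {p : Y × ℝ | p.1 ∈ D ∧ p.2 < F p.1 + -m}
      {p : Y × ℝ | (∀ c, A c p.1 = 0) ∧ p.2 = 0} := by
    rw [Set.disjoint_left]
    rintro ⟨v, s⟩ ⟨h1, h2⟩ ⟨h3, h4⟩
    have := hm v h1 h3
    simp only at h2 h4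
    linarith
  -- Separate the open strict hypograph of `F - m` from the feasible subspace at height `0`; they
  -- are disjoint because `m` bounds `F` on feasible points.
  obtain ⟨f, u, hU, ht⟩ := geometric_hahn_banach_open hG.convex_strict_hypograph hUo htc hdisj
  let φ : Y →ₗ[ℝ] ℝ := f.toLinearMap ∘ₗ LinearMap.inl ℝ Y ℝ
  have hf : ∀ v s, f (v, s) = φ v + s * f (0, 1) := by
    intro v s
    have h : ((v, s) : Y × ℝ) = (v, 0) + s • (0, 1) := by simp
    rw [h, map_add, map_smul, smul_eq_mul]
    rfl
  set μ := f (0, 1)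
  have hker : ∀ v, (∀ c, A c v = 0) → u ≤ φ v := by
    intro v hv
    have := ht (v, 0) ⟨hv, rfl⟩
    rwa [hf, zero_mul, add_zero] at this
  have hu : u ≤ 0 := by simpa using hker 0 (by simp)
  -- A linear functional bounded below on a subspace vanishes there.
  have hφ : ∀ v, (∀ c, A c v = 0) → φ v = 0 := by
    intro v hv
    by_contra hne
    have := hker (((u - 1) / φ v) • v) (fun c => by simp [hv c])
    rw [map_smul, smul_eq_mul, div_mul_cancel₀ _ hne] at this
    linarith
  have hμ : 0 < μ := by
    -- Slater's condition enters here: below the feasible interior point `v₀` the hypograph contains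
    -- a point of negative height, and this determines the sign of `μ`.
    have h := hU (v₀, min (F v₀ + -m - 1) (-1)) ⟨hv₀, by
      have := min_le_left (F v₀ + -m - 1) (-1)
      show min (F v₀ + -m - 1) (-1) < _
      linarith⟩
    rw [hf, hφ v₀ hA, zero_add] at h
    have h1 := min_le_right (F v₀ + -m - 1) (-1)
    by_contra! hle
    have := mul_nonneg_of_nonpos_of_nonpos (h1.trans (by norm_num : (-1 : ℝ) ≤ 0)) hle
    linarith
  have hspan : φ ∈ Submodule.span ℝ (Set.range A) := by
    refine mem_span_of_iInf_ker_le_ker fun v hv => ?_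
    rw [Submodule.mem_iInf] at hv
    exact hφ v hv
  obtain ⟨w, hw⟩ := (Submodule.mem_span_range_iff_exists_fun ℝ).1 hspan
  refine ⟨fun c => w c / μ, fun v hv => ?_⟩
  have hsum : ∑ c, w c / μ * A c v = φ v / μ := by
    rw [← hw, LinearMap.sum_apply, Finset.sum_div]
    refine Finset.sum_congr rfl fun c _ => ?_
    rw [LinearMap.smul_apply, smul_eq_mul]
    ring
  rw [hsum]
  -- The separation inequality, divided by `μ`; the height `s` is then let up to `F v - m`.
  have key : ∀ s < F v + -m, s ≤ -φ v / μ := by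
    intro s hs
    have := hU (v, s) ⟨hv, hs⟩
    rw [hf] at this
    rw [le_div_iff₀ hμ]
    linarith
  have := le_of_forall_lt_imp_le_of_dense key
  rw [neg_div] at this
  linarith

/-! ## Lagrange multipliers for the volume -/

/-- The total volume of a family of triples of angles. -/
noncomputable def totalVolume {T : Type*} [Fintype T] (w : T → Fin 3 → ℝ) : ℝ :=
  ∑ σ, ∑ i, lobachevsky (w σ i)

/-- The projection of triples of numbers onto the triples of sum zero. -/
noncomputable def sumZeroProj (T : Type*) : (T → Fin 3 → ℝ) →ₗ[ℝ] (T → Fin 3 → ℝ) where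
  toFun v σ i := v σ i - (∑ j, v σ j) / 3
  map_add' v w := by
    funext σ i
    simp only [Pi.add_apply, Finset.sum_add_distrib]; ring
  map_smul' r v := by
    funext σ i
    simp only [Pi.smul_apply, smul_eq_mul, ← Finset.mul_sum, RingHom.id_apply]; ring

theorem sum_sumZeroProj {T : Type*} (v : T → Fin 3 → ℝ) (σ : T) :
    ∑ i, sumZeroProj T v σ i = 0 := by
  simp [sumZeroProj, Finset.sum_sub_distrib]
  ring

theorem sumZeroProj_eq {T : Type*} {v : T → Fin 3 → ℝ} (h : ∀ σ, ∑ i, v σ i = 0) :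
    sumZeroProj T v = v := by
  funext σ i
  simp [sumZeroProj, h σ]

theorem continuous_totalVolume {T : Type*} [Fintype T] :
    Continuous (totalVolume : (T → Fin 3 → ℝ) → ℝ) := by
  unfold totalVolume
  have := continuous_lobachevsky
  fun_prop

/-- Add, with weights `s` and `t`, the supporting hyperplane inequalities at the convex combination;
the linear terms cancel. -/
theorem sum_lobachevsky_concave {a b : Fin 3 → ℝ} (ha : ∀ i, 0 < a i) (has : ∑ i, a i = Real.pi)
    (hb : ∀ i, 0 < b i) (hbs : ∑ i, b i = Real.pi) {s t : ℝ} (hs : 0 ≤ s) (ht : 0 ≤ t)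
    (hst : s + t = 1) :
    s * ∑ i, lobachevsky (a i) + t * ∑ i, lobachevsky (b i) ≤
      ∑ i, lobachevsky (s * a i + t * b i) := by
  have hzs : ∑ i, (s * a i + t * b i) = Real.pi := by
    rw [Finset.sum_add_distrib, ← Finset.mul_sum, ← Finset.mul_sum, has, hbs, ← add_mul, hst,
      one_mul]
  have hz : ∀ i, 0 < s * a i + t * b i := by
    intro i
    rcases hs.eq_or_lt with rfl | hs
    · have : t = 1 := by linarith
      simpa [this] using hb i
    · have := mul_pos hs (ha i)
      have := mul_nonneg ht (hb i).le
      linarith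
  have h1 := mul_le_mul_of_nonneg_left
    (sum_lobachevsky_le hz hzs (b := a) ⟨fun i => (ha i).le, has⟩) hs
  have h2 := mul_le_mul_of_nonneg_left
    (sum_lobachevsky_le hz hzs (b := b) ⟨fun i => (hb i).le, hbs⟩) ht
  have h3 : s * ∑ i, Real.log (Real.sin (s * a i + t * b i)) * (a i - (s * a i + t * b i)) +
      t * ∑ i, Real.log (Real.sin (s * a i + t * b i)) * (b i - (s * a i + t * b i)) = 0 := by
    rw [Finset.mul_sum, Finset.mul_sum, ← Finset.sum_add_distrib]
    refine Finset.sum_eq_zero fun i _ => ?_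
    have ht' : t = 1 - s := by linarith
    rw [ht']; ring
  have h4 : s * ∑ i, lobachevsky (s * a i + t * b i) + t * ∑ i, lobachevsky (s * a i + t * b i) =
      ∑ i, lobachevsky (s * a i + t * b i) := by rw [← add_mul, hst, one_mul]
  linarith

/-- Strong duality needs an open domain, so triples of sum `π` are written as `θ + sumZeroProj T v`
with `v` unrestricted. This yields the inequality for positive triples; continuity extends it to the
boundary. -/
theorem exists_lagrange_multiplier_totalVolume {T ι : Type*} [Fintype T] [Fintype ι]
    (B : ι → (T → Fin 3 → ℝ) →ₗ[ℝ] ℝ) (b : ι → ℝ) {θ : T → Fin 3 → ℝ}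
    (hθ : ∀ σ i, 0 < θ σ i) (hθs : ∀ σ, ∑ i, θ σ i = Real.pi) (hθb : ∀ c, B c θ = b c) {m : ℝ}
    (hmax : ∀ β : T → Fin 3 → ℝ, (∀ σ, β σ ∈ angleSimplex) → (∀ c, B c β = b c) →
      totalVolume β ≤ m) :
    ∃ r : ι → ℝ, ∀ β : T → Fin 3 → ℝ, (∀ σ, β σ ∈ angleSimplex) →
      totalVolume β + ∑ c, r c * (B c β - b c) ≤ m := by
  have hPc : Continuous (sumZeroProj T) := LinearMap.continuous_of_finiteDimensional _
  have hsum : ∀ v σ, ∑ i, (θ + sumZeroProj T v) σ i = Real.pi := by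
    intro v σ
    simp only [Pi.add_apply, Finset.sum_add_distrib, hθs, sum_sumZeroProj, add_zero]
  have hDo : IsOpen {v : T → Fin 3 → ℝ | ∀ σ i, 0 < (θ + sumZeroProj T v) σ i} := by
    simp only [Set.ofPred_forall]
    refine isOpen_iInter_of_finite fun σ => isOpen_iInter_of_finite fun i => ?_
    refine isOpen_lt continuous_const ?_
    fun_prop
  have hcomb : ∀ (x y : T → Fin 3 → ℝ) (s t : ℝ), s + t = 1 → ∀ σ i,
      (θ + sumZeroProj T (s • x + t • y)) σ i =
        s * (θ + sumZeroProj T x) σ i + t * (θ + sumZeroProj T y) σ i := by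
    intro x y s t hst σ i
    simp only [map_add, map_smul, Pi.add_apply, Pi.smul_apply, smul_eq_mul]
    have ht' : t = 1 - s := by linarith
    rw [ht']; ring
  have hF : ConcaveOn ℝ {v : T → Fin 3 → ℝ | ∀ σ i, 0 < (θ + sumZeroProj T v) σ i}
      (fun v => totalVolume (θ + sumZeroProj T v)) := by
    refine ⟨fun x hx y hy s t hs ht hst σ i => ?_, fun x hx y hy s t hs ht hst => ?_⟩
    · rw [hcomb x y s t hst σ i]
      rcases hs.eq_or_lt with rfl | hs
      · have : t = 1 := by linarith
        rw [this]
        simpa using hy σ i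
      · have := mul_pos hs (hx σ i)
        have := mul_nonneg ht (hy σ i).le
        linarith
    · simp only [totalVolume, smul_eq_mul, hcomb x y s t hst,
        Finset.mul_sum (s := Finset.univ (α := T)), ← Finset.sum_add_distrib]
      exact Finset.sum_le_sum fun σ _ =>
        sum_lobachevsky_concave (hx σ) (hsum x σ) (hy σ) (hsum y σ) hs ht hst
  have hFc : Continuous (fun v => totalVolume (θ + sumZeroProj T v)) :=
    continuous_totalVolume.comp (continuous_const.add hPc)
  obtain ⟨r, hr⟩ := exists_lagrange_multiplier hDo hF hFc.continuousOn
    (fun c => B c ∘ₗ sumZeroProj T) (m := m) (v₀ := 0) (by simpa using hθ) (by simp) (by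
      intro v hv hA
      refine hmax _ (fun σ => ⟨fun i => (hv σ i).le, hsum v σ⟩) fun c => ?_
      have := hA c
      simp only [LinearMap.comp_apply] at this
      rw [map_add, this, hθb, add_zero])
  refine ⟨r, fun β hβ => ?_⟩
  have hBc : ∀ c, Continuous (B c) := fun c => LinearMap.continuous_of_finiteDimensional _
  -- The segment from `β` to the positive family `θ` is positive for `0 < ε < 1`; the limit `ε → 0`
  -- gives the claim at `β`.
  let g : ℝ → T → Fin 3 → ℝ := fun ε => β + ε • (θ - β)
  have hg : Continuous g := by fun_prop
  have hev : ∀ᶠ ε in 𝓝[>] (0 : ℝ),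
      totalVolume (g ε) + ∑ c, r c * (B c (g ε) - b c) ≤ m := by
    filter_upwards [Ioo_mem_nhdsGT (show (0 : ℝ) < 1 by norm_num)] with ε hε
    have hP : sumZeroProj T (g ε - θ) = g ε - θ := by
      refine sumZeroProj_eq fun σ => ?_
      simp only [g, Pi.sub_apply, Pi.add_apply, Pi.smul_apply, smul_eq_mul,
        Finset.sum_sub_distrib, Finset.sum_add_distrib, ← Finset.mul_sum, hθs, (hβ σ).2]
      ring
    have hθg : θ + sumZeroProj T (g ε - θ) = g ε := by rw [hP]; abel
    have h := hr (g ε - θ) (by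
      intro σ i
      rw [hθg]
      have h1 := mul_pos hε.1 (hθ σ i)
      have h2 := mul_nonneg (sub_nonneg.2 hε.2.le) ((hβ σ).1 i)
      simp only [g, Pi.add_apply, Pi.smul_apply, Pi.sub_apply, smul_eq_mul]
      linarith)
    simp only [LinearMap.comp_apply] at h
    rw [hθg, hP] at h
    simpa only [map_sub, hθb] using h
  have hcont : Continuous fun ε => totalVolume (g ε) + ∑ c, r c * (B c (g ε) - b c) := by
    refine (continuous_totalVolume.comp hg).add (continuous_finsetSum _ fun c _ => ?_)
    exact continuous_const.mul (((hBc c).comp hg).sub continuous_const)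
  have hlim := (hcont.tendsto 0).mono_left (nhdsWithin_le_nhds (s := Ioi 0))
  have hg0 : g 0 = β := by simp [g]
  simp only [hg0] at hlim
  exact le_of_tendsto hlim hev

/-! ## Opposite edges of a tetrahedron -/

/-- The edge from the vertex `0` to the vertex `i + 1`, which represents the `i`-th pair of
opposite edges. -/
def pairEdge (i : Fin 3) : TetEdge := edge 0 i.succ (Fin.succ_ne_zero i).symm

/-- The index of the pair of opposite edges that contains a given edge. -/
def pairIdx (e : TetEdge) : Fin 3 :=
  if e = pairEdge 0 ∨ e = (pairEdge 0).opp then 0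
  else if e = pairEdge 1 ∨ e = (pairEdge 1).opp then 1 else 2

theorem univ_tetEdge : (Finset.univ : Finset TetEdge) =
    {pairEdge 0, (pairEdge 0).opp, pairEdge 1, (pairEdge 1).opp, pairEdge 2,
      (pairEdge 2).opp} := by
  decide

theorem forall_tetEdge {p : TetEdge → Prop} (h : ∀ i, p (pairEdge i) ∧ p (pairEdge i).opp)
    (e : TetEdge) : p e := by
  have he : e ∈ (Finset.univ : Finset TetEdge) := Finset.mem_univ e
  rw [univ_tetEdge] at he
  simp only [Finset.mem_insert, Finset.mem_singleton] at he
  rcases he with rfl | rfl | rfl | rfl | rfl | rfl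
  exacts [(h 0).1, (h 0).2, (h 1).1, (h 1).2, (h 2).1, (h 2).2]

theorem pairIdx_pairEdge (i : Fin 3) : pairIdx (pairEdge i) = i := by
  revert i; decide

theorem pairIdx_opp_pairEdge (i : Fin 3) : pairIdx (pairEdge i).opp = i := by
  revert i; decide

theorem opp_opp (e : TetEdge) : e.opp.opp = e := Subtype.ext (compl_compl e.1)

theorem eq_or_eq_opp_of_pairIdx_eq {e e' : TetEdge} (h : pairIdx e = pairIdx e') :
    e = e' ∨ e = e'.opp := by
  revert e'
  refine forall_tetEdge (p := fun e => ∀ {e' : TetEdge}, pairIdx e = pairIdx e' →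
    e = e' ∨ e = e'.opp) (fun i => ⟨fun {e'} => ?_, fun {e'} => ?_⟩) e <;>
  refine forall_tetEdge (p := fun e' => pairIdx _ = pairIdx e' → _ = e' ∨ _ = e'.opp)
    (fun j => ?_) e' <;>
  simp only [opp_opp, pairIdx_pairEdge, pairIdx_opp_pairEdge] <;>
  constructor <;> rintro rfl <;> simp

theorem sum_tetEdge (f : TetEdge → ℝ) :
    ∑ e, f e = ∑ i, (f (pairEdge i) + f (pairEdge i).opp) := by
  rw [univ_tetEdge, Finset.sum_insert (by decide), Finset.sum_insert (by decide),
    Finset.sum_insert (by decide), Finset.sum_insert (by decide), Finset.sum_insert (by decide),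
    Finset.sum_singleton, Fin.sum_univ_three]
  ring

theorem edge_opp {i j k m : Fin 4} (hij : i ≠ j) (hik : i ≠ k) (him : i ≠ m) (hjk : j ≠ k)
    (hjm : j ≠ m) (hkm : k ≠ m) : (edge i j hij).opp = edge k m hkm := by
  revert i j k m; decide

theorem pairIdx_edge_ne {i j k : Fin 4} (hij : i ≠ j) (hik : i ≠ k) (hjk : j ≠ k) :
    pairIdx (edge i j hij) ≠ pairIdx (edge i k hik) := by
  revert i j k; decide

theorem edge_comm {i j : Fin 4} (h : i ≠ j) : edge i j h = edge j i h.symm :=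
  Subtype.ext (Finset.pair_comm i j)

/-- The half sum of the lengths of each pair of opposite edges. -/
noncomputable def halfSum (l : TetEdge → ℝ) (i : Fin 3) : ℝ :=
  (l (pairEdge i) + l (pairEdge i).opp) / 2

theorem halfSum_pairIdx (l : TetEdge → ℝ) (e : TetEdge) :
    halfSum l (pairIdx e) = (l e + l e.opp) / 2 := by
  refine forall_tetEdge (p := fun e => halfSum l (pairIdx e) = (l e + l e.opp) / 2)
    (fun i => ?_) e
  simp [opp_opp, pairIdx_pairEdge, pairIdx_opp_pairEdge, halfSum, add_comm]

/-- In terms of the angles of the pairs of opposite edges, the angles at each vertex of a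
tetrahedron are the three angles. -/
theorem sum_vertex_pairIdx [∀ (v : Fin 4) (e : TetEdge), Decidable (v ∈ e.1)] (w : Fin 3 → ℝ)
    (v : Fin 4) : ∑ e : TetEdge with v ∈ e.1, w (pairIdx e) = ∑ i, w i := by
  rw [Finset.sum_filter, sum_tetEdge]
  refine Finset.sum_congr rfl fun i _ => ?_
  rw [pairIdx_pairEdge, pairIdx_opp_pairEdge]
  have : v ∈ (pairEdge i).opp.1 ↔ v ∉ (pairEdge i).1 := by simp [TetEdge.opp]
  by_cases h : v ∈ (pairEdge i).1 <;> simp [h, this]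

/-- Opposite angles are equal. -/
theorem eq_pairIdx_of_vertex_sum [∀ (v : Fin 4) (e : TetEdge), Decidable (v ∈ e.1)]
    {a : TetEdge → ℝ} {s : ℝ} (h : ∀ v : Fin 4, ∑ e : TetEdge with v ∈ e.1, a e = s)
    (e : TetEdge) : a e = a (pairEdge (pairIdx e)) := by
  have hv : ∀ v : Fin 4, ∑ i, ((if v ∈ (pairEdge i).1 then a (pairEdge i) else 0) +
      (if v ∈ (pairEdge i).1 then 0 else a (pairEdge i).opp)) = s := by
    intro v
    rw [← h v, Finset.sum_filter, sum_tetEdge]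
    refine Finset.sum_congr rfl fun i _ => ?_
    have : v ∈ (pairEdge i).opp.1 ↔ v ∉ (pairEdge i).1 := by simp [TetEdge.opp]
    by_cases h : v ∈ (pairEdge i).1 <;> simp [h, this]
  have h0 := hv 0
  have h1 := hv 1
  have h2 := hv 2
  have h3 := hv 3
  simp [Fin.sum_univ_three, pairEdge, edge] at h0 h1 h2 h3
  refine forall_tetEdge (p := fun e => a e = a (pairEdge (pairIdx e))) (fun i => ?_) e
  rw [pairIdx_pairEdge, pairIdx_opp_pairEdge]
  refine ⟨rfl, ?_⟩
  -- The equations at the two ends of an edge minus those at the other two vertices leave twice the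
  -- difference of the opposite angles.
  fin_cases i <;> simp [pairEdge, edge] <;> linarith

/-! ## The Minkowski form -/

theorem mink_comm (x y : Fin 4 → ℝ) : mink x y = mink y x := by
  unfold mink; ring

theorem mink_add_left (x y z : Fin 4 → ℝ) : mink (x + y) z = mink x z + mink y z := by
  simp only [mink, Pi.add_apply]; ring

theorem mink_smul_left (r : ℝ) (x y : Fin 4 → ℝ) : mink (r • x) y = r * mink x y := by
  simp only [mink, Pi.smul_apply, smul_eq_mul]; ring

theorem mink_add_right (x y z : Fin 4 → ℝ) : mink x (y + z) = mink x y + mink x z := by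
  simp only [mink, Pi.add_apply]; ring

theorem mink_smul_right (r : ℝ) (x y : Fin 4 → ℝ) : mink x (r • y) = r * mink x y := by
  simp only [mink, Pi.smul_apply, smul_eq_mul]; ring

theorem sq_dot_le (a b c x y z : ℝ) :
    (a * x + b * y + c * z) ^ 2 ≤ (a ^ 2 + b ^ 2 + c ^ 2) * (x ^ 2 + y ^ 2 + z ^ 2) := by
  nlinarith [sq_nonneg (a * y - b * x), sq_nonneg (a * z - c * x), sq_nonneg (b * z - c * y)]

/-- The combination `v 0 • u - u 0 • v` has time coordinate `0`, so its norm is non-negative and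
vanishes only if the combination does. This norm is `-2 * (u 0 * v 0 * mink u v)`. -/
theorem mink_neg_of_mem_lightCone {u v : Fin 4 → ℝ} (hu : u ∈ lightCone) (hv : v ∈ lightCone)
    (h : LinearIndependent ℝ ![u, v]) : mink u v < 0 := by
  by_contra! hle
  have hx : v 0 • u + (-u 0) • v = 0 := by
    have h0 := mul_nonneg (mul_pos hu.2 hv.2).le hle
    have h1 : mink (v 0 • u + (-u 0) • v) (v 0 • u + (-u 0) • v) =
        -2 * (u 0 * v 0 * mink u v) := by
      simp only [mink_add_left, mink_add_right, mink_smul_left, mink_smul_right, hu.1, hv.1,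
        mink_comm v u]
      ring
    have h2 : (v 0 • u + (-u 0) • v) 0 = 0 := by
      simp only [Pi.add_apply, Pi.smul_apply, smul_eq_mul]; ring
    generalize v 0 • u + (-u 0) • v = x at h1 h2
    simp only [mink, h2] at h1
    simp only [mink] at h0
    have h3 : x 1 ^ 2 + x 2 ^ 2 + x 3 ^ 2 ≤ 0 := by nlinarith
    have e1 : x 1 = 0 := by nlinarith [sq_nonneg (x 1), sq_nonneg (x 2), sq_nonneg (x 3)]
    have e2 : x 2 = 0 := by nlinarith [sq_nonneg (x 1), sq_nonneg (x 2), sq_nonneg (x 3)]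
    have e3 : x 3 = 0 := by nlinarith [sq_nonneg (x 1), sq_nonneg (x 2), sq_nonneg (x 3)]
    funext i
    fin_cases i <;> assumption
  have := (LinearIndependent.pair_iff.1 h (v 0) (-u 0) hx).1
  exact hv.2.ne' this

theorem mink_self_nonneg_of_orthogonal {t w : Fin 4 → ℝ} (ht : mink t t < 0)
    (h : mink w t = 0) : 0 ≤ mink w w := by
  by_contra! hlt
  simp only [mink] at ht h hlt
  have hc := sq_dot_le (w 1) (w 2) (w 3) (t 1) (t 2) (t 3)
  have h1 : w 1 * t 1 + w 2 * t 2 + w 3 * t 3 = w 0 * t 0 := by linarith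
  rw [h1] at hc
  have hA : w 1 ^ 2 + w 2 ^ 2 + w 3 ^ 2 < w 0 ^ 2 := by linarith
  have hB : t 1 ^ 2 + t 2 ^ 2 + t 3 ^ 2 < t 0 ^ 2 := by linarith
  have := mul_lt_mul'' hA hB (by positivity) (by positivity)
  nlinarith

theorem pos_of_mink_neg {x u : Fin 4 → ℝ} (hx : mink x x < 0) (hu : u ∈ lightCone)
    (h : mink x u < 0) : 0 < x 0 := by
  by_contra! hle
  obtain ⟨hu0, hupos⟩ := hu
  simp only [mink] at hx h hu0
  have hc := sq_dot_le (x 1) (x 2) (x 3) (u 1) (u 2) (u 3)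
  have hA : x 1 ^ 2 + x 2 ^ 2 + x 3 ^ 2 < x 0 ^ 2 := by linarith
  have hB : u 1 ^ 2 + u 2 ^ 2 + u 3 ^ 2 = u 0 ^ 2 := by linarith
  rw [hB] at hc
  have h1 : x 1 * u 1 + x 2 * u 2 + x 3 * u 3 < x 0 * u 0 := by linarith
  have h2 : x 0 * u 0 ≤ 0 := mul_nonpos_of_nonpos_of_nonneg hle hupos.le
  have h3 : (x 0 * u 0) ^ 2 < (x 1 * u 1 + x 2 * u 2 + x 3 * u 3) ^ 2 := by nlinarith
  have h4 : (x 1 ^ 2 + x 2 ^ 2 + x 3 ^ 2) * u 0 ^ 2 ≤ x 0 ^ 2 * u 0 ^ 2 :=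
    mul_le_mul_of_nonneg_right hA.le (by positivity)
  nlinarith

/-! ## Dihedral angles -/

/-- Orthogonality to `u` and `v` determines the direction. The component of `x` orthogonal to both
has norm `2 * q * r / p`, which fixes the positive scale. -/
theorem isFaceDirection_iff {u v x w : Fin 4 → ℝ} (hu : mink u u = 0) (hv : mink v v = 0)
    (hx : mink x x = 0) {p q r : ℝ} (hp : 0 < p) (hq : 0 < q) (hr : 0 < r)
    (huv : mink u v = -p) (hux : mink u x = -q) (hvx : mink v x = -r) :
    IsFaceDirection u v x w ↔
      w = √(p / (2 * q * r)) • ((-(r / p)) • u + (-(q / p)) • v + x) := by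
  have hvu : mink v u = -p := by rw [mink_comm, huv]
  have hxu : mink x u = -q := by rw [mink_comm, hux]
  have hxv : mink x v = -r := by rw [mink_comm, hvx]
  constructor
  · rintro ⟨⟨a, b, c, hc, rfl⟩, h1, h2, h3⟩
    simp only [mink_add_left, mink_add_right, mink_smul_left, mink_smul_right, hu, hv, hx, huv,
      hux, hvx, hvu, hxu, hxv] at h1 h2 h3
    have hb : b = c * (-(q / p)) := by field_simp; linarith
    have ha : a = c * (-(r / p)) := by field_simp; linarith
    have hcs : c = √(p / (2 * q * r)) := by
      symm
      rw [Real.sqrt_eq_iff_mul_self_eq (by positivity) hc.le]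
      rw [hb, ha] at h3
      have h4 : c * c * (2 * q * r / p) = 1 := by
        rw [← h3]
        field_simp
        ring
      field_simp at h4 ⊢
      linarith
    rw [← hcs, ha, hb, smul_add, smul_add, smul_smul, smul_smul]
  · rintro rfl
    have hk : √(p / (2 * q * r)) * √(p / (2 * q * r)) = p / (2 * q * r) :=
      Real.mul_self_sqrt (by positivity)
    have hk0 : 0 < √(p / (2 * q * r)) := Real.sqrt_pos.2 (by positivity)
    generalize √(p / (2 * q * r)) = κ at hk hk0
    refine ⟨⟨κ * (-(r / p)), κ * (-(q / p)), κ, hk0, by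
      rw [smul_add, smul_add, smul_smul, smul_smul]⟩, ?_, ?_, ?_⟩
    · simp only [mink_add_left, mink_smul_left, hu, hvu, hxu]
      field_simp; ring
    · simp only [mink_add_left, mink_smul_left, hv, huv, hxv]
      field_simp; ring
    · simp only [mink_add_left, mink_add_right, mink_smul_left, mink_smul_right, hu, hv, hx, huv,
        hux, hvx, hvu, hxu, hxv]
      calc _ = κ * κ * (2 * q * r / p) := by field_simp; ring
        _ = 1 := by rw [hk]; field_simp

/-- The product of the two explicit unit normals is the law-of-cosines expression for the triangle
whose sides are `exp` of the half sums of opposite lengths. -/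
theorem isDihedralAngle_iff {u v x y : Fin 4 → ℝ} (hu : mink u u = 0) (hv : mink v v = 0)
    (hx : mink x x = 0) (hy : mink y y = 0) {luv lux lvx luy lvy lxy : ℝ}
    (huv : mink u v = -(2 * Real.exp luv)) (hux : mink u x = -(2 * Real.exp lux))
    (hvx : mink v x = -(2 * Real.exp lvx)) (huy : mink u y = -(2 * Real.exp luy))
    (hvy : mink v y = -(2 * Real.exp lvy)) (hxy : mink x y = -(2 * Real.exp lxy)) (θ : ℝ) :
    IsDihedralAngle u v x y θ ↔ θ = Real.arccos
      ((Real.exp ((lux + lvy) / 2) ^ 2 + Real.exp ((lvx + luy) / 2) ^ 2 -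
        Real.exp ((luv + lxy) / 2) ^ 2) /
        (2 * Real.exp ((lux + lvy) / 2) * Real.exp ((lvx + luy) / 2))) := by
  have hw := fun w => isFaceDirection_iff (w := w) hu hv hx (by positivity) (by positivity)
    (by positivity) huv hux hvx
  have hw' := fun w => isFaceDirection_iff (w := w) hu hv hy (by positivity) (by positivity)
    (by positivity) huv huy hvy
  have hvu := (mink_comm v u).trans huv
  have hxu := (mink_comm x u).trans hux
  have hxv := (mink_comm x v).trans hvx
  unfold IsDihedralAngle
  simp only [hw, hw']
  suffices h : mink
      (√(2 * Real.exp luv / (2 * (2 * Real.exp lux) * (2 * Real.exp lvx))) •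
        ((-(2 * Real.exp lvx / (2 * Real.exp luv))) • u +
          (-(2 * Real.exp lux / (2 * Real.exp luv))) • v + x))
      (√(2 * Real.exp luv / (2 * (2 * Real.exp luy) * (2 * Real.exp lvy))) •
        ((-(2 * Real.exp lvy / (2 * Real.exp luv))) • u +
          (-(2 * Real.exp luy / (2 * Real.exp luv))) • v + y)) =
      (Real.exp ((lux + lvy) / 2) ^ 2 + Real.exp ((lvx + luy) / 2) ^ 2 -
        Real.exp ((luv + lxy) / 2) ^ 2) /
        (2 * Real.exp ((lux + lvy) / 2) * Real.exp ((lvx + luy) / 2)) by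
    constructor
    · rintro ⟨w, w', rfl, rfl, hθ⟩
      rwa [h] at hθ
    · intro hθ
      exact ⟨_, _, rfl, rfl, by rwa [h]⟩
  have e : ∀ s : ℝ, Real.exp s = Real.exp (s / 2) ^ 2 := by
    intro s; rw [sq, ← Real.exp_add, add_halves]
  have s1 : √(2 * Real.exp luv / (2 * (2 * Real.exp lux) * (2 * Real.exp lvx))) =
      Real.exp (luv / 2) / (2 * (Real.exp (lux / 2) * Real.exp (lvx / 2))) := by
    rw [Real.sqrt_eq_iff_mul_self_eq (by positivity) (by positivity), e luv, e lux, e lvx]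
    field_simp
  have s2 : √(2 * Real.exp luv / (2 * (2 * Real.exp luy) * (2 * Real.exp lvy))) =
      Real.exp (luv / 2) / (2 * (Real.exp (luy / 2) * Real.exp (lvy / 2))) := by
    rw [Real.sqrt_eq_iff_mul_self_eq (by positivity) (by positivity), e luv, e luy, e lvy]
    field_simp
  rw [s1, s2]
  simp only [mink_add_left, mink_add_right, mink_smul_left, mink_smul_right, hu, hv, huv,
    hvu, hxu, hxv, huy, hvy, hxy, add_div, Real.exp_add]
  rw [e luv, e lux, e lvx, e luy, e lvy, e lxy]
  field_simp
  ring

/-! ## Signed lengths -/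

theorem cosh_log_half {c : ℝ} (hc : 0 < c) : Real.cosh (Real.log (c / 2)) = c / 4 + 1 / c := by
  rw [Real.cosh_log (by positivity)]
  field_simp; ring

theorem mem_horosphere_inter_geodesic {u v x : Fin 4 → ℝ} (hu : u ∈ lightCone)
    (hv : v ∈ lightCone) {c : ℝ} (hc : 0 < c) (huv : mink u v = -c) :
    x ∈ horosphere u ∩ geodesic u v ↔ x = (1 / 2 : ℝ) • u + (1 / c) • v := by
  have hvu : mink v u = -c := by rw [mink_comm, huv]
  constructor
  · rintro ⟨⟨⟨h1, -⟩, h2⟩, -, a, b, ha, hb, rfl⟩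
    simp only [mink_add_left, mink_add_right, mink_smul_left, mink_smul_right, hu.1, hv.1, huv,
      hvu] at h1 h2
    have hb' : b = 1 / c := by field_simp; linarith
    have ha' : a = 1 / 2 := by
      have : -(2 * a) = -1 := by
        rw [← h1, hb']
        field_simp
        ring
      linarith
    rw [ha', hb']
  · rintro rfl
    have hmem : (1 / 2 : ℝ) • u + (1 / c) • v ∈ hyperbolicSpace := by
      refine ⟨?_, ?_⟩
      · simp only [mink_add_left, mink_add_right, mink_smul_left, mink_smul_right, hu.1, hv.1, huv,
          hvu]
        field_simp; ring
      · have h1 := hu.2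
        have h2 := hv.2
        simp only [Pi.add_apply, Pi.smul_apply, smul_eq_mul]
        positivity
    refine ⟨⟨hmem, ?_⟩, hmem, 1 / 2, 1 / c, by positivity, by positivity, rfl⟩
    simp only [mink_add_left, mink_smul_left, hu.1, hvu]
    field_simp; ring

/-- For a common point `x`, the vector `x - (u + v) / c` is orthogonal to `u + v` and has norm `2 /
c - 1`. If `2 < c` this is negative although `u + v` is timelike, a contradiction; if `c ≤ 2`, a
multiple of `w` with that norm produces a common point. -/
theorem disjoint_horosphere_iff {u v w : Fin 4 → ℝ} (hu : u ∈ lightCone)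
    (hv : v ∈ lightCone) {c : ℝ} (hc : 0 < c) (huv : mink u v = -c)
    (hwu : mink w u = 0) (hwv : mink w v = 0) (hw : mink w w = 1) :
    Disjoint (horosphere u) (horosphere v) ↔ 2 < c := by
  have hvu : mink v u = -c := by rw [mink_comm, huv]
  have huw : mink u w = 0 := by rw [mink_comm, hwu]
  have hvw : mink v w = 0 := by rw [mink_comm, hwv]
  constructor
  · intro hd
    by_contra! hle
    have hs : √(2 / c - 1) * √(2 / c - 1) = 2 / c - 1 :=
      Real.mul_self_sqrt (by rw [sub_nonneg, le_div_iff₀ hc]; linarith)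
    generalize √(2 / c - 1) = r at hs
    have h1 : mink ((1 / c) • u + (1 / c) • v + r • w) ((1 / c) • u + (1 / c) • v + r • w) =
        -1 := by
      simp only [mink_add_left, mink_add_right, mink_smul_left, mink_smul_right, hu.1, hv.1, huv,
        hvu, hwu, hwv, huw, hvw, hw]
      calc _ = -(2 / c) + r * r := by field_simp; ring
        _ = -1 := by rw [hs]; ring
    have h2 : mink ((1 / c) • u + (1 / c) • v + r • w) u = -1 := by
      simp only [mink_add_left, mink_smul_left, hu.1, hvu, hwu]
      field_simp; ring
    have h3 : mink ((1 / c) • u + (1 / c) • v + r • w) v = -1 := by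
      simp only [mink_add_left, mink_smul_left, hv.1, huv, hwv]
      field_simp; ring
    have h0 := pos_of_mink_neg (by rw [h1]; norm_num) hu (by rw [h2]; norm_num)
    exact Set.disjoint_left.1 hd ⟨⟨h1, h0⟩, h2⟩ ⟨⟨h1, h0⟩, h3⟩
  · intro hlt
    rw [Set.disjoint_left]
    rintro x ⟨⟨hx, -⟩, hxu⟩ ⟨-, hxv⟩
    have hux : mink u x = -1 := by rw [mink_comm, hxu]
    have hvx : mink v x = -1 := by rw [mink_comm, hxv]
    have h1 : mink (u + v) (u + v) < 0 := by
      simp only [mink_add_left, mink_add_right, hu.1, hv.1, huv, hvu]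
      linarith
    have h2 : mink (x + (-(1 / c)) • (u + v)) (u + v) = 0 := by
      simp only [mink_add_left, mink_add_right, mink_smul_left, hu.1, hv.1, huv, hvu, hxu, hxv]
      field_simp; ring
    have h3 := mink_self_nonneg_of_orthogonal h1 h2
    simp only [mink_add_left, mink_add_right, mink_smul_left, mink_smul_right, hu.1, hv.1, huv,
      hvu, hxu, hxv, hux, hvx, hx] at h3
    have h4 : 0 ≤ 2 / c - 1 := by
      refine h3.trans_eq ?_
      field_simp; ring
    rw [sub_nonneg, le_div_iff₀ hc] at h4
    linarith

/-- With `c = -mink u v`, each horosphere meets the geodesic in one point, and the two points are at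
distance `|log (c / 2)|`. Disjointness, that is `2 < c`, supplies the sign. -/
theorem isSignedLength_iff {u v w : Fin 4 → ℝ} (hu : u ∈ lightCone)
    (hv : v ∈ lightCone) (hneg : mink u v < 0)
    (hwu : mink w u = 0) (hwv : mink w v = 0) (hw : mink w w = 1) (ℓ : ℝ) :
    IsSignedLength u v ℓ ↔ mink u v = -(2 * Real.exp ℓ) := by
  obtain ⟨c, hc⟩ : ∃ c, c = -mink u v := ⟨_, rfl⟩
  have hc0 : 0 < c := by linarith
  have huv : mink u v = -c := by linarith
  have hvu : mink v u = -c := by rw [mink_comm, huv]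
  have hgeo : geodesic u v = geodesic v u := by
    have : ∀ u v : Fin 4 → ℝ, geodesic u v ⊆ geodesic v u := by
      rintro u v x ⟨hx, a, b, ha, hb, rfl⟩
      exact ⟨hx, b, a, hb, ha, add_comm _ _⟩
    exact (this u v).antisymm (this v u)
  have hd : hdist ((1 / 2 : ℝ) • u + (1 / c) • v) ((1 / 2 : ℝ) • v + (1 / c) • u) =
      |Real.log (c / 2)| := by
    have : -mink ((1 / 2 : ℝ) • u + (1 / c) • v) ((1 / 2 : ℝ) • v + (1 / c) • u) =
        c / 4 + 1 / c := by
      simp only [mink_add_left, mink_add_right, mink_smul_left, mink_smul_right, hu.1, hv.1, huv,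
        hvu]
      field_simp; ring
    rw [hdist, this, ← cosh_log_half hc0, ← Real.cosh_abs, Real.arcosh_cosh (abs_nonneg _)]
  have hlen : (∃ p ∈ horosphere u ∩ geodesic u v, ∃ q ∈ horosphere v ∩ geodesic u v,
      |ℓ| = hdist p q) ↔ |ℓ| = |Real.log (c / 2)| := by
    have h1 := fun x => mem_horosphere_inter_geodesic (x := x) hu hv hc0 huv
    have h2 := fun x => mem_horosphere_inter_geodesic (x := x) hv hu hc0 hvu
    rw [← hgeo] at h2
    simp only [h1, h2, exists_eq_left, hd]
  have hlog : 0 < Real.log (c / 2) ↔ 2 < c := by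
    rw [Real.log_pos_iff (by positivity), lt_div_iff₀ two_pos, one_mul]
  have hexp : mink u v = -(2 * Real.exp ℓ) ↔ ℓ = Real.log (c / 2) := by
    rw [huv, neg_inj]
    constructor
    · rintro rfl
      rw [mul_div_cancel_left₀ _ two_ne_zero, Real.log_exp]
    · rintro rfl
      rw [Real.exp_log (by positivity)]
      ring
  rw [IsSignedLength, hlen, disjoint_horosphere_iff hu hv hc0 huv hwu hwv hw, hexp, ← hlog]
  constructor
  · rintro ⟨h1, h2⟩
    rcases abs_eq_abs.1 h1 with h | h
    · exact h
    · rcases lt_trichotomy (Real.log (c / 2)) 0 with h3 | h3 | h3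
      · have := h2.1 (by linarith)
        linarith
      · linarith
      · have := h2.2 h3
        linarith
  · rintro rfl
    exact ⟨rfl, Iff.rfl⟩

/-! ## Decorated ideal tetrahedra of given lengths or angles -/

theorem exists_other_vertex (i j : Fin 4) : ∃ k, i ≠ k ∧ j ≠ k := by
  revert i j; decide

theorem DecoratedIdealTetrahedron.mink_neg (D : DecoratedIdealTetrahedron) {i j : Fin 4}
    (h : i ≠ j) : mink (D.vert i) (D.vert j) < 0 := by
  refine mink_neg_of_mem_lightCone (D.mem_lightCone i) (D.mem_lightCone j) ?_
  have := D.linearIndependent.comp ![i, j] (by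
    intro a b hab
    fin_cases a <;> fin_cases b <;> simp_all [h.symm])
  convert this using 1
  funext a
  fin_cases a <;> rfl

theorem DecoratedIdealTetrahedron.hasLengths_iff (D : DecoratedIdealTetrahedron)
    (l : TetEdge → ℝ) : D.HasLengths l ↔ ∀ (i j : Fin 4) (h : i ≠ j),
      mink (D.vert i) (D.vert j) = -(2 * Real.exp (l (edge i j h))) := by
  refine forall_congr' fun i => forall_congr' fun j => forall_congr' fun h => ?_
  obtain ⟨k, hik, hjk⟩ := exists_other_vertex i j
  -- The face direction towards a third vertex serves as the unit vector orthogonal to the edge.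
  obtain ⟨-, h1, h2, h3⟩ := (isFaceDirection_iff (D.mem_lightCone i).1 (D.mem_lightCone j).1
    (D.mem_lightCone k).1 (neg_pos.2 (D.mink_neg h)) (neg_pos.2 (D.mink_neg hik))
    (neg_pos.2 (D.mink_neg hjk)) (neg_neg _).symm (neg_neg _).symm (neg_neg _).symm).2 rfl
  exact isSignedLength_iff (D.mem_lightCone i) (D.mem_lightCone j) (D.mink_neg h) h1 h2 h3 _

/-- The cosine of the angle opposite to the `i`-th side of a triangle with side lengths
`exp ∘ L`. -/
noncomputable def triangleCos (L : Fin 3 → ℝ) (i j k : Fin 3) : ℝ :=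
  (Real.exp (L j) ^ 2 + Real.exp (L k) ^ 2 - Real.exp (L i) ^ 2) /
    (2 * Real.exp (L j) * Real.exp (L k))

theorem DecoratedIdealTetrahedron.HasLengths.isDihedralAngle_iff {D : DecoratedIdealTetrahedron}
    {l : TetEdge → ℝ} (hl : D.HasLengths l) {i j k m : Fin 4} (hij : i ≠ j) (hik : i ≠ k)
    (him : i ≠ m) (hjk : j ≠ k) (hjm : j ≠ m) (hkm : k ≠ m) (θ : ℝ) :
    IsDihedralAngle (D.vert i) (D.vert j) (D.vert k) (D.vert m) θ ↔
      θ = Real.arccos (triangleCos (halfSum l) (pairIdx (edge i j hij))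
        (pairIdx (edge i k hik)) (pairIdx (edge j k hjk))) := by
  rw [D.hasLengths_iff] at hl
  rw [IdealTriangulation.isDihedralAngle_iff (D.mem_lightCone i).1 (D.mem_lightCone j).1
    (D.mem_lightCone k).1 (D.mem_lightCone m).1 (hl i j hij) (hl i k hik) (hl j k hjk)
    (hl i m him) (hl j m hjm) (hl k m hkm), triangleCos, halfSum_pairIdx, halfSum_pairIdx,
    halfSum_pairIdx, edge_opp hij hik him hjk hjm hkm, edge_opp hik hij him hjk.symm hkm hjm,
    edge_opp hjk hij.symm hjm hik.symm hkm him]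

theorem triangleCos_of_log_sin {L w : Fin 3 → ℝ} (hw : ∀ i, 0 < w i)
    (hs : ∑ i, w i = Real.pi) {c : ℝ} (hc : ∀ i, L i = Real.log (Real.sin (w i)) + c)
    {i j k : Fin 3} (hij : i ≠ j) (hik : i ≠ k) (hjk : j ≠ k) :
    triangleCos L i j k = Real.cos (w i) := by
  have he : ∀ i, Real.exp (L i) = Real.sin (w i) * Real.exp c := fun i => by
    rw [hc i, Real.exp_add, Real.exp_log (sin_pos_of_pos hw hs i)]
  have hs' := hs
  rw [sum_fin_three hij hik hjk] at hs'
  have hcos := cos_eq_of_sum_eq_pi hs'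
  have hj := sin_pos_of_pos hw hs j
  have hk := sin_pos_of_pos hw hs k
  have h0 := Real.exp_pos c
  rw [triangleCos, he, he, he, div_eq_iff (by positivity)]
  linear_combination (-(Real.exp c ^ 2)) * hcos

/-- The law of sines, deduced from the law of cosines; the common ratio becomes the additive
constant. -/
theorem log_sin_of_arccos_triangleCos {L w : Fin 3 → ℝ} (hw : ∀ i, 0 < w i)
    (hs : ∑ i, w i = Real.pi) (h : ∀ i j k, i ≠ j → i ≠ k → j ≠ k →
      w i = Real.arccos (triangleCos L i j k)) :
    ∃ c, ∀ i, L i = Real.log (Real.sin (w i)) + c := by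
  have hcos : ∀ i j k, i ≠ j → i ≠ k → j ≠ k → Real.cos (w i) = triangleCos L i j k := by
    intro i j k hij hik hjk
    have h1 := h i j k hij hik hjk
    rw [h1]
    refine Real.cos_arccos ?_ ?_
    -- Outside `[-1, 1]` `Real.arccos` takes the value `0` or `π`, which the angles here do not
    -- attain.
    · by_contra! hlt
      rw [Real.arccos_of_le_neg_one hlt.le] at h1
      exact (lt_pi_of_pos hw hs i).ne h1
    · by_contra! hlt
      rw [Real.arccos_of_one_le hlt.le] at h1
      exact (hw i).ne' h1
  have hprod : ∀ i j, i ≠ j →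
      Real.sin (w i) * Real.exp (L j) = Real.sin (w j) * Real.exp (L i) := by
    intro i j hij
    obtain ⟨k, hik, hjk⟩ := exists_third i j hij
    have c1 := hcos i j k hij hik hjk
    have c2 := hcos j i k hij.symm hjk hik
    have p1 := Real.sin_sq_add_cos_sq (w i)
    have p2 := Real.sin_sq_add_cos_sq (w j)
    rw [triangleCos, eq_div_iff (by positivity)] at c1 c2
    have xi := Real.exp_pos (L i)
    have xj := Real.exp_pos (L j)
    have xk := Real.exp_pos (L k)
    have si := sin_pos_of_pos hw hs i
    have sj := sin_pos_of_pos hw hs j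
    generalize Real.exp (L i) = x at *
    generalize Real.exp (L j) = y at *
    generalize Real.exp (L k) = z at *
    have hsq : (Real.sin (w i) * y) ^ 2 = (Real.sin (w j) * x) ^ 2 := by
      have hz : (2 * z) ^ 2 ≠ 0 := by positivity
      refine mul_left_cancel₀ hz ?_
      -- Both sides are Heron's expression for sixteen times the squared area, which is symmetric in
      -- the sides.
      have q1 : (2 * z) ^ 2 * (Real.sin (w i) * y) ^ 2 =
          (2 * y * z) ^ 2 - (y ^ 2 + z ^ 2 - x ^ 2) ^ 2 := by
        rw [← c1]; linear_combination (2 * y * z) ^ 2 * p1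
      have q2 : (2 * z) ^ 2 * (Real.sin (w j) * x) ^ 2 =
          (2 * x * z) ^ 2 - (x ^ 2 + z ^ 2 - y ^ 2) ^ 2 := by
        rw [← c2]; linear_combination (2 * x * z) ^ 2 * p2
      rw [q1, q2]; ring
    exact (pow_left_inj₀ (by positivity) (by positivity) two_ne_zero).1 hsq
  refine ⟨L 0 - Real.log (Real.sin (w 0)), fun i => ?_⟩
  by_cases h0 : i = 0
  · rw [h0]; ring
  · have := congrArg Real.log (hprod i 0 h0)
    rw [Real.log_mul (sin_pos_of_pos hw hs i).ne' (Real.exp_pos _).ne',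
      Real.log_mul (sin_pos_of_pos hw hs 0).ne' (Real.exp_pos _).ne', Real.log_exp,
      Real.log_exp] at this
    linarith

/-- The light-like vector, scaled by `r`, of the point `(x, y)` of the plane, regarded as the
complement of a point in the sphere at infinity. -/
noncomputable def planePoint (r x y : ℝ) : Fin 4 → ℝ :=
  ![r * (1 + (x ^ 2 + y ^ 2)), r * (2 * x), r * (2 * y), r * ((x ^ 2 + y ^ 2) - 1)]

theorem planePoint_mem_lightCone {r : ℝ} (hr : 0 < r) (x y : ℝ) :
    planePoint r x y ∈ lightCone := by
  refine ⟨?_, ?_⟩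
  · simp [mink, planePoint]; ring
  · simp only [planePoint, Matrix.cons_val_zero]
    positivity

theorem mink_planePoint (r x y r' x' y' : ℝ) : mink (planePoint r x y) (planePoint r' x' y') =
    -(2 * (r * r' * ((x - x') ^ 2 + (y - y') ^ 2))) := by
  simp [mink, planePoint]; ring

/-- In the upper half-space picture `![1, 0, 0, 1]` is the point at infinity. The conditions on `x`
and `y` make the three planar points non-collinear, hence the four vectors independent. -/
theorem exists_decoratedIdealTetrahedron_of_plane {r x y : Fin 3 → ℝ} (hr : ∀ i, 0 < r i)
    (h0 : x 0 = 0 ∧ y 0 = 0) (h1 : x 1 ≠ 0 ∧ y 1 = 0) (h2 : y 2 ≠ 0) :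
    ∃ D : DecoratedIdealTetrahedron,
      (∀ i : Fin 3, mink (D.vert 0) (D.vert i.succ) = -(2 * r i)) ∧
      ∀ i j : Fin 3, mink (D.vert i.succ) (D.vert j.succ) =
        -(2 * (r i * r j * ((x i - x j) ^ 2 + (y i - y j) ^ 2))) := by
  refine ⟨⟨Fin.cons ![1, 0, 0, 1] fun i => planePoint (r i) (x i) (y i), ?_, ?_⟩, ?_, ?_⟩
  · intro i
    refine Fin.cases ?_ (fun i => ?_) i
    · simp [lightCone, mink]
    · exact planePoint_mem_lightCone (hr i) _ _
  · rw [Fintype.linearIndependent_iff]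
    intro g hg
    have hv : g 0 • ![1, 0, 0, 1] + g 1 • planePoint (r 0) (x 0) (y 0) +
        g 2 • planePoint (r 1) (x 1) (y 1) + g 3 • planePoint (r 2) (x 2) (y 2) = 0 := by
      rw [← hg, Fin.sum_univ_four]; rfl
    have e0 := congrFun hv 0
    have e1 := congrFun hv 1
    have e2 := congrFun hv 2
    have e3 := congrFun hv 3
    simp [planePoint, h0.1, h0.2, h1.2] at e0 e1 e2 e3
    have r0 := (hr 0).ne'
    have r1 := (hr 1).ne'
    have r2 := (hr 2).ne'
    have g3 : g 3 = 0 := by simpa [h2, r2] using e2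
    have g2 : g 2 = 0 := by simpa [g3, h1.1, r1] using e1
    simp only [g2, g3, zero_mul, add_zero] at e0 e3
    have g1 : g 1 = 0 := by
      have : g 1 * r 0 = 0 := by linarith
      exact (mul_eq_zero.1 this).resolve_right r0
    have g0 : g 0 = 0 := by simpa [g1] using e0
    intro i
    fin_cases i <;> assumption
  · intro i
    simp [mink, planePoint]; ring
  · intro i j
    exact mink_planePoint _ _ _ _ _ _

theorem areAnglesOfLengths_of_log_sin {l : TetEdge → ℝ} {w : Fin 3 → ℝ} (hw : ∀ i, 0 < w i)
    (hs : ∑ i, w i = Real.pi) {c : ℝ} (hc : ∀ i, halfSum l i = Real.log (Real.sin (w i)) + c) :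
    AreAnglesOfLengths l (fun e => w (pairIdx e)) := by
  have hsin := sin_pos_of_pos hw hs
  -- The planar points form a triangle with angles `w` and sides `M * sin (w k)`. The radii `exp (l
  -- (pairEdge i))` give the right lengths at the vertex at infinity; this `M` is the scale at which
  -- the three opposite lengths also come out right.
  set M := Real.exp (c - (l (pairEdge 0) + l (pairEdge 1) + l (pairEdge 2)) / 2) with hM
  have hM0 : 0 < M := Real.exp_pos _
  obtain ⟨D, hD0, hD⟩ := exists_decoratedIdealTetrahedron_of_plane
    (r := fun i => Real.exp (l (pairEdge i)))
    (x := ![0, M * Real.sin (w 2), M * (Real.sin (w 1) * Real.cos (w 0))])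
    (y := ![0, 0, M * (Real.sin (w 1) * Real.sin (w 0))])
    (fun i => Real.exp_pos _) ⟨rfl, rfl⟩ ⟨(mul_pos hM0 (hsin 2)).ne', rfl⟩
    (mul_pos hM0 (mul_pos (hsin 1) (hsin 0))).ne'
  have hopp : ∀ i, Real.exp (l (pairEdge i).opp) * Real.exp (l (pairEdge i)) =
      Real.sin (w i) ^ 2 * Real.exp c ^ 2 := by
    intro i
    rw [← mul_pow, ← Real.exp_add]
    have : Real.sin (w i) * Real.exp c = Real.exp (halfSum l i) := by
      rw [hc i, Real.exp_add, Real.exp_log (hsin i)]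
    rw [this, sq, ← Real.exp_add, halfSum]
    congr 1; ring
  have hM2 : M ^ 2 * (Real.exp (l (pairEdge 0)) * Real.exp (l (pairEdge 1)) *
      Real.exp (l (pairEdge 2))) = Real.exp c ^ 2 := by
    rw [hM, sq, sq, ← Real.exp_add, ← Real.exp_add, ← Real.exp_add, ← Real.exp_add,
      ← Real.exp_add]
    congr 1; ring
  have hdist : ∀ i j k : Fin 3, ∀ d : ℝ, i ≠ j → i ≠ k → j ≠ k →
      d = M ^ 2 * Real.sin (w k) ^ 2 →
      Real.exp (l (pairEdge i)) * Real.exp (l (pairEdge j)) * d =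
        Real.exp (l (pairEdge k).opp) := by
    intro i j k d hij hik hjk hd
    have hprod : Real.exp (l (pairEdge 0)) * Real.exp (l (pairEdge 1)) *
        Real.exp (l (pairEdge 2)) = Real.exp (l (pairEdge i)) * Real.exp (l (pairEdge j)) *
        Real.exp (l (pairEdge k)) := by
      have := sum_fin_three hij hik hjk (fun i => l (pairEdge i))
      rw [Fin.sum_univ_three] at this
      simp only [← Real.exp_add]
      rw [this]
    have hk := Real.exp_pos (l (pairEdge k))
    refine mul_right_cancel₀ hk.ne' ?_
    rw [hopp, ← hM2, hprod, hd]
    ring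
  have hlen : D.HasLengths l := by
    rw [D.hasLengths_iff]
    have hsucc : ∀ i j k : Fin 3, ∀ h : i.succ ≠ j.succ, i ≠ j → i ≠ k → j ≠ k →
        edge i.succ j.succ h = (pairEdge k).opp := by decide
    have hsum := hs
    rw [Fin.sum_univ_three] at hsum
    have hcos := cos_eq_of_sum_eq_pi hsum
    have hsq := Real.sin_sq_add_cos_sq (w 0)
    have d01 := hdist 0 1 2 ((0 - M * Real.sin (w 2)) ^ 2 + (0 - 0) ^ 2) (by decide) (by decide)
      (by decide) (by ring)
    have d02 := hdist 0 2 1 ((0 - M * (Real.sin (w 1) * Real.cos (w 0))) ^ 2 +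
      (0 - M * (Real.sin (w 1) * Real.sin (w 0))) ^ 2) (by decide) (by decide)
      (by decide) (by linear_combination (M ^ 2 * Real.sin (w 1) ^ 2) * hsq)
    have d12 := hdist 1 2 0 ((M * Real.sin (w 2) - M * (Real.sin (w 1) * Real.cos (w 0))) ^ 2 +
      (0 - M * (Real.sin (w 1) * Real.sin (w 0))) ^ 2) (by decide) (by decide)
      (by decide) (by
        linear_combination (M ^ 2 * Real.sin (w 1) ^ 2) * hsq - M ^ 2 * hcos)
    have m01 : mink (D.vert (Fin.succ 0)) (D.vert (Fin.succ 1)) =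
        -(2 * Real.exp (l (pairEdge 2).opp)) := by
      rw [hD 0 1, ← d01]; rfl
    have m02 : mink (D.vert (Fin.succ 0)) (D.vert (Fin.succ 2)) =
        -(2 * Real.exp (l (pairEdge 1).opp)) := by
      rw [hD 0 2, ← d02]; rfl
    have m12 : mink (D.vert (Fin.succ 1)) (D.vert (Fin.succ 2)) =
        -(2 * Real.exp (l (pairEdge 0).opp)) := by
      rw [hD 1 2, ← d12]; rfl
    have hlt : ∀ (i j : Fin 4) (h : i ≠ j), i < j →
        mink (D.vert i) (D.vert j) = -(2 * Real.exp (l (edge i j h))) := by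
      intro i j h hlt
      refine Fin.cases (fun h hlt => ?_) (fun i h hlt => ?_) i h hlt
      · refine Fin.cases (fun h hlt => absurd rfl h) (fun j h hlt => hD0 j) j h hlt
      · refine Fin.cases (fun h hlt => absurd hlt (Fin.not_lt_zero _))
          (fun j h hlt => ?_) j h hlt
        have : (i = 0 ∧ j = 1) ∨ (i = 0 ∧ j = 2) ∨ (i = 1 ∧ j = 2) := by
          clear * - hlt; revert i j; decide
        rcases this with ⟨rfl, rfl⟩ | ⟨rfl, rfl⟩ | ⟨rfl, rfl⟩
        · rw [hsucc 0 1 2 h (by decide) (by decide) (by decide)]; exact m01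
        · rw [hsucc 0 2 1 h (by decide) (by decide) (by decide)]; exact m02
        · rw [hsucc 1 2 0 h (by decide) (by decide) (by decide)]; exact m12
    intro i j h
    rcases lt_or_gt_of_ne h with hl | hl
    · exact hlt i j h hl
    · rw [mink_comm, edge_comm h]
      exact hlt j i h.symm hl
  refine ⟨D, hlen, fun i j k m hij hik him hjk hjm hkm => ?_⟩
  rw [hlen.isDihedralAngle_iff hij hik him hjk hjm hkm]
  have h3 : pairIdx (edge i k hik) ≠ pairIdx (edge j k hjk) := by
    rw [edge_comm hik, edge_comm hjk]
    exact pairIdx_edge_ne hik.symm hjk.symm hij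
  have h2 : pairIdx (edge i j hij) ≠ pairIdx (edge j k hjk) := by
    rw [edge_comm hij]
    exact pairIdx_edge_ne hij.symm hjk hik
  rw [triangleCos_of_log_sin hw hs hc (pairIdx_edge_ne hij hik hjk) h2 h3,
    Real.arccos_cos (hw _).le (lt_pi_of_pos hw hs _).le]

theorem pairIdx_edge_succ {i j k : Fin 3} (hij : i ≠ j) (hik : i ≠ k) (hjk : j ≠ k) :
    pairIdx (edge i.succ j.succ ((Fin.succ_injective _).ne hij)) = k := by
  revert i j k; decide

/-- For the forward direction it suffices to read off the dihedral angles at the three edges from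
vertex `0`. -/
theorem areAnglesOfLengths_iff {l : TetEdge → ℝ} {w : Fin 3 → ℝ} (hw : ∀ i, 0 < w i)
    (hs : ∑ i, w i = Real.pi) : AreAnglesOfLengths l (fun e => w (pairIdx e)) ↔
      ∃ c, ∀ i, halfSum l i = Real.log (Real.sin (w i)) + c := by
  refine ⟨?_, fun ⟨c, hc⟩ => areAnglesOfLengths_of_log_sin hw hs hc⟩
  rintro ⟨D, hl, ha⟩
  refine log_sin_of_arccos_triangleCos hw hs fun i j k hij hik hjk => ?_
  have h0 : ∀ i : Fin 3, (0 : Fin 4) ≠ i.succ := fun i => (Fin.succ_ne_zero i).symm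
  have hsucc : ∀ {i j : Fin 3}, i ≠ j → i.succ ≠ j.succ := fun h => (Fin.succ_injective _).ne h
  have h := ha 0 i.succ j.succ k.succ (h0 i) (h0 j) (h0 k) (hsucc hij) (hsucc hik) (hsucc hjk)
  rw [hl.isDihedralAngle_iff (h0 i) (h0 j) (h0 k) (hsucc hij) (hsucc hik) (hsucc hjk)] at h
  have e1 : pairIdx (edge 0 i.succ (h0 i)) = i := pairIdx_pairEdge i
  have e2 : pairIdx (edge 0 j.succ (h0 j)) = j := pairIdx_pairEdge j
  have e3 : pairIdx (edge i.succ j.succ (hsucc hij)) = k := pairIdx_edge_succ hij hik hjk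
  simpa only [e1, e2, e3] using h

/-! ## The two cases for a single tetrahedron -/

theorem isFlatWithLengths_iff {l : TetEdge → ℝ} {w : Fin 3 → ℝ} :
    IsFlatWithLengths l (fun e => w (pairIdx e)) ↔
      ∃ i j k, i ≠ j ∧ i ≠ k ∧ j ≠ k ∧ w i = Real.pi ∧ w j = 0 ∧ w k = 0 ∧
        Real.exp (halfSum l j) + Real.exp (halfSum l k) ≤ Real.exp (halfSum l i) := by
  constructor
  · rintro ⟨e₁, e₂, e₃, h23, h23', h1, -, h2, -, h3, -, hle⟩
    change w (pairIdx e₁) = _ at h1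
    change w (pairIdx e₂) = _ at h2
    change w (pairIdx e₃) = _ at h3
    refine ⟨pairIdx e₁, pairIdx e₂, pairIdx e₃, ?_, ?_, ?_, h1, h2, h3, ?_⟩
    · intro h
      rw [h, h2] at h1
      exact Real.pi_ne_zero h1.symm
    · intro h
      rw [h, h3] at h1
      exact Real.pi_ne_zero h1.symm
    · intro h
      exact (eq_or_eq_opp_of_pairIdx_eq h).elim h23 h23'
    · simpa only [halfSum_pairIdx] using hle
  · rintro ⟨i, j, k, -, -, hjk, hi, hj, hk, hle⟩
    refine ⟨pairEdge i, pairEdge j, pairEdge k, ?_, ?_, ?_⟩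
    · exact fun h => hjk (by rw [← pairIdx_pairEdge j, h, pairIdx_pairEdge])
    · exact fun h => hjk (by rw [← pairIdx_pairEdge j, h, pairIdx_opp_pairEdge])
    · simp only [pairIdx_pairEdge, pairIdx_opp_pairEdge, hi, hj, hk, true_and]
      exact hle

theorem isBalanced_halfSum_iff {l : TetEdge → ℝ} {w : Fin 3 → ℝ} (hw : w ∈ angleSimplex) :
    ((∀ e, 0 < w (pairIdx e)) → AreAnglesOfLengths l (fun e => w (pairIdx e))) ∧
      ((∃ e, w (pairIdx e) = 0) → IsFlatWithLengths l (fun e => w (pairIdx e))) ↔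
    IsBalanced (halfSum l) w := by
  rw [isFlatWithLengths_iff]
  constructor
  · rintro ⟨h1, h2⟩
    by_cases hpos : ∀ i, 0 < w i
    · exact Or.inl ⟨hpos, (areAnglesOfLengths_iff hpos hw.2).1 (h1 fun e => hpos _)⟩
    · push Not at hpos
      obtain ⟨i, hi⟩ := hpos
      exact Or.inr (h2 ⟨pairEdge i, by
        rw [pairIdx_pairEdge]; exact le_antisymm hi (hw.1 i)⟩)
  · rintro (⟨hpos, h⟩ | ⟨i, j, k, h⟩)
    · exact ⟨fun _ => (areAnglesOfLengths_iff hpos hw.2).2 h,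
        fun ⟨e, he⟩ => absurd he (hpos _).ne'⟩
    · refine ⟨fun hpos => absurd h.2.2.2.2.1 ?_, fun _ => ⟨i, j, k, h⟩⟩
      have := hpos (pairEdge j)
      rw [pairIdx_pairEdge] at this
      exact this.ne'

/-! ## Angle structures as families of triples of angles -/

namespace ClosedTriangulation

variable {T : Type*} (τ : ClosedTriangulation T)

instance [Finite T] : Finite τ.Edge := Quot.finite _

/-- The family of angles with given angles at the pairs of opposite edges. -/
def liftAngles (w : T → Fin 3 → ℝ) : T → TetEdge → ℝ := fun σ e => w σ (pairIdx e)

/-- The half sums of the lengths of opposite edges in a tetrahedron of the triangulation. -/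
noncomputable def halfSums (l : τ.Edge → ℝ) (σ : T) : Fin 3 → ℝ :=
  halfSum fun e => l (τ.edgeOf σ e)

theorem induces_liftAngles_iff {l : τ.Edge → ℝ} {w : T → Fin 3 → ℝ}
    (hw : ∀ σ, w σ ∈ angleSimplex) :
    τ.Induces l (liftAngles w) ↔ ∀ σ, IsBalanced (τ.halfSums l σ) (w σ) :=
  forall_congr' fun σ => isBalanced_halfSum_iff (hw σ)

variable [Fintype T]

open Classical in
/-- The sum of the angles around an edge of the triangulation. -/
noncomputable def edgeSum (c : τ.Edge) : (T → Fin 3 → ℝ) →ₗ[ℝ] ℝ where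
  toFun w := ∑ x : T × TetEdge with τ.edgeOf x.1 x.2 = c, liftAngles w x.1 x.2
  map_add' v w := by
    simp [liftAngles, Finset.sum_add_distrib]
  map_smul' r v := by
    simp [liftAngles, Finset.mul_sum]

open Classical in
theorem edgeSum_apply (c : τ.Edge) (w : T → Fin 3 → ℝ) : τ.edgeSum c w =
    ∑ x : T × TetEdge with τ.edgeOf x.1 x.2 = c, liftAngles w x.1 x.2 := rfl

theorem isNonnegAngleStructure_liftAngles {w : T → Fin 3 → ℝ} :
    τ.IsNonnegAngleStructure (liftAngles w) ↔
      (∀ σ, w σ ∈ angleSimplex) ∧ ∀ c, τ.edgeSum c w = 2 * Real.pi := by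
  classical
  constructor
  · rintro ⟨h1, h2, h3⟩
    refine ⟨fun σ => ⟨fun i => ?_, ?_⟩, h2⟩
    · simpa only [liftAngles, pairIdx_pairEdge] using h1 σ (pairEdge i)
    · rw [← h3 σ 0]
      exact (sum_vertex_pairIdx (w σ) 0).symm
  · rintro ⟨h1, h2⟩
    refine ⟨fun σ e => (h1 σ).1 _, h2, fun σ v => ?_⟩
    rw [← (h1 σ).2]
    exact sum_vertex_pairIdx (w σ) v

variable {τ} in
theorem IsNonnegAngleStructure.exists_liftAngles {α : T → TetEdge → ℝ}
    (hα : τ.IsNonnegAngleStructure α) : ∃ w, α = liftAngles w := by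
  classical
  exact ⟨fun σ i => α σ (pairEdge i), funext fun σ => funext fun e =>
    eq_pairIdx_of_vertex_sum (hα.vertex_sum σ) e⟩

theorem volume_liftAngles (w : T → Fin 3 → ℝ) : volume (liftAngles w) = totalVolume w := by
  refine Finset.sum_congr rfl fun σ _ => ?_
  rw [sum_tetEdge, Finset.mul_sum]
  refine Finset.sum_congr rfl fun i _ => ?_
  simp only [liftAngles, pairIdx_pairEdge, pairIdx_opp_pairEdge]
  ring

/-- Summation over classes of edges becomes summation over tetrahedra. Opposite edges carry the same
angle, so their lengths combine to twice the half sum. -/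
theorem sum_mul_edgeSum [Fintype τ.Edge] (l : τ.Edge → ℝ) (w : T → Fin 3 → ℝ) :
    ∑ c, l c * τ.edgeSum c w = 2 * ∑ σ, ∑ i, τ.halfSums l σ i * w σ i := by
  classical
  calc ∑ c, l c * τ.edgeSum c w
      = ∑ c, ∑ x : T × TetEdge with τ.edgeOf x.1 x.2 = c,
          l (τ.edgeOf x.1 x.2) * liftAngles w x.1 x.2 := by
        refine Finset.sum_congr rfl fun c _ => ?_
        rw [edgeSum_apply, Finset.mul_sum]
        refine Finset.sum_congr (by congr) fun x hx => ?_
        rw [(Finset.mem_filter.1 hx).2]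
    _ = ∑ x : T × TetEdge, l (τ.edgeOf x.1 x.2) * liftAngles w x.1 x.2 :=
        Finset.sum_fiberwise _ _ _
    _ = _ := by
        rw [Fintype.sum_prod_type, Finset.mul_sum]
        refine Finset.sum_congr rfl fun σ _ => ?_
        rw [sum_tetEdge, Finset.mul_sum]
        refine Finset.sum_congr rfl fun i _ => ?_
        simp only [liftAngles, pairIdx_pairEdge, pairIdx_opp_pairEdge, halfSums, halfSum]
        ring

theorem sum_energy_eq [Fintype τ.Edge] (l : τ.Edge → ℝ) (w : T → Fin 3 → ℝ) :
    ∑ σ, energy (τ.halfSums l σ) (w σ) = totalVolume w + (∑ c, l c * τ.edgeSum c w) / 2 := by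
  rw [τ.sum_mul_edgeSum]
  simp only [energy, totalVolume, Finset.sum_add_distrib]
  ring

/-! ### Duality: from volume maximizers to lengths and back -/

variable {τ}

theorem IsVolumeMaximizer.exists_induces (hpos : ∃ θ, τ.IsPosAngleStructure θ)
    {α : T → TetEdge → ℝ} (hα : τ.IsVolumeMaximizer α) : ∃ l : τ.Edge → ℝ, τ.Induces l α := by
  classical
  have := Fintype.ofFinite τ.Edge
  obtain ⟨θ', hθ', hθpos⟩ := hpos
  obtain ⟨θ, rfl⟩ := hθ'.exists_liftAngles
  obtain ⟨hα, hmax⟩ := hα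
  obtain ⟨w, rfl⟩ := hα.exists_liftAngles
  rw [isNonnegAngleStructure_liftAngles] at hα hθ'
  obtain ⟨r, hr⟩ := exists_lagrange_multiplier_totalVolume τ.edgeSum (fun _ => 2 * Real.pi)
    (θ := θ) (fun σ i => by
      simpa only [liftAngles, pairIdx_pairEdge] using hθpos σ (pairEdge i))
    (fun σ => (hθ'.1 σ).2) hθ'.2 (m := totalVolume w) (fun β hβ hβb => by
      rw [← volume_liftAngles, ← volume_liftAngles]
      exact hmax _ (τ.isNonnegAngleStructure_liftAngles.2 ⟨hβ, hβb⟩))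
  -- The factor `2` compensates for the half in `sum_energy_eq`.
  refine ⟨fun c => 2 * r c, (τ.induces_liftAngles_iff hα.1).2 fun σ => ?_⟩
  refine isBalanced_of_isMaxOn (hα.1 σ) fun a ha => ?_
  have hle : ∀ β : T → Fin 3 → ℝ, (∀ σ, β σ ∈ angleSimplex) →
      ∑ σ, energy (τ.halfSums (fun c => 2 * r c) σ) (β σ) ≤
        ∑ σ, energy (τ.halfSums (fun c => 2 * r c) σ) (w σ) := by
    intro β hβ
    have h1 := hr β hβ
    have h2 : ∀ v : T → Fin 3 → ℝ, (∑ c, 2 * r c * τ.edgeSum c v) / 2 =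
        ∑ c, r c * τ.edgeSum c v := by
      intro v
      simp only [mul_assoc, ← Finset.mul_sum]
      ring
    rw [sum_energy_eq, sum_energy_eq, h2, h2]
    simp only [mul_sub, Finset.sum_sub_distrib] at h1
    simp only [hα.2]
    linarith
  -- The Lagrangian is no longer subject to edge equations, so one tetrahedron can be varied alone;
  -- the other terms cancel.
  have h := hle (Function.update w σ a) (fun σ' => by
    by_cases hs : σ' = σ
    · subst hs; simpa using ha
    · simpa [hs] using hα.1 σ')
  rw [← sub_nonneg, ← Finset.sum_sub_distrib, Finset.sum_eq_single σ (fun σ' _ hs => by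
    simp [hs]) (fun hn => absurd (Finset.mem_univ σ) hn), Function.update_self, sub_nonneg] at h
  exact h

/-- Weak duality: each energy is maximal at `α`, and the linear part of their sum is the same for
all angle structures. -/
theorem Induces.isVolumeMaximizer {l : τ.Edge → ℝ} {α : T → TetEdge → ℝ}
    (hα : τ.IsNonnegAngleStructure α) (h : τ.Induces l α) : τ.IsVolumeMaximizer α := by
  have := Fintype.ofFinite τ.Edge
  refine ⟨hα, fun β hβ => ?_⟩
  obtain ⟨w, rfl⟩ := hα.exists_liftAngles
  obtain ⟨v, rfl⟩ := hβ.exists_liftAngles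
  rw [isNonnegAngleStructure_liftAngles] at hα hβ
  rw [induces_liftAngles_iff τ hα.1] at h
  have hle : ∑ σ, energy (τ.halfSums l σ) (v σ) ≤ ∑ σ, energy (τ.halfSums l σ) (w σ) :=
    Finset.sum_le_sum fun σ _ => (h σ).isMaxOn (hα.1 σ) (hβ.1 σ)
  rw [sum_energy_eq, sum_energy_eq] at hle
  simp only [hα.2, hβ.2] at hle
  rw [volume_liftAngles, volume_liftAngles]
  linarith

end ClosedTriangulation

end IdealTriangulation

theorem theorem1p3 {T : Type*} [Fintype T] (τ : IdealTriangulation.ClosedTriangulation T)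
    (hpos : ∃ θ : T → IdealTriangulation.TetEdge → ℝ, τ.IsPosAngleStructure θ) :
    (∀ α : T → IdealTriangulation.TetEdge → ℝ, τ.IsVolumeMaximizer α →
      ∃ l : τ.Edge → ℝ, τ.Induces l α) ∧
    (∀ (l : τ.Edge → ℝ) (α : T → IdealTriangulation.TetEdge → ℝ),
      τ.IsNonnegAngleStructure α → τ.Induces l α → τ.IsVolumeMaximizer α) :=
  ⟨fun _ hα => hα.exists_induces hpos, fun _ _ hα h => h.isVolumeMaximizer hα⟩
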